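/- Let $n\ge 2$, $t_0\in\mathbb{R}$, $a_0,\dots,a_{n-1}\in\mathbb{C}$, $a_n=1$, let $r_0,\dots,r_{n-1}:[t_0,\infty)\to\mathbb{C}$ be locally integrable and put $r_n\equiv 0$. Consider $$y^{(n)}(t)+\sum_{i=0}^{n-1}(a_i+r_i(t))\,y^{(i)}(t)=0\qquad\text{on }[t_0,\infty),\tag{1}$$ where a solution is a $C^{n-1}$ function with locally absolutely continuous $y^{(n-1)}$ that satisfies (1) almost everywhere. Notation. For $c=(c_0,\dots,c_n)$ write $P(c;x)=\sum_{i=0}^n c_i x^i$. Suppose that the roots $\lambda,\lambda_1,\dots,\lambda_{n-1}$ of $P(a;x)$ have pairwise distinct real parts, and put $$\gamma_j=\lambda_j-\lambda,\qquad \alpha_j=\Re\gamma_j,\qquad \Gamma_j=\prod_{k\ne j}(\gamma_j-\gamma_k),\qquad \tilde\alpha_j=\sum_{i=0}^{n-2}|\gamma_j|^i .$$ For $\Re\omega\neq 0$ let $g_\omega(t,s)=-\operatorname{sgn}(\Re\omega)\,e^{\omega(t-s)}$ if $\operatorname{sgn}(\Re\omega)(t-s)<0$ and $g_\omega(t,s)=0$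 otherwise, and $$G_\omega[f](t)=\int_{t_0}^{\infty}g_\omega(t,s)f(s)\,ds,\qquad I_\omega[f](t)=\int_{t_0}^{\infty}|g_\omega(t,s)f(s)|\,ds,\qquad G[f]=\sum_{j=1}^{n-1}\frac1{\Gamma_j}G_{\gamma_j}[f],$$ where the integral in $G_\omega$ is understood as $\lim_{T\to\infty}\int_{t_0}^T$. Let $B_0=1$ and $B_{i+1}(x_1,\dots,x_{i+1})=\sum_{j=0}^{i}\binom ij B_{i-j}(x_1,\dots,x_{i-j})\,x_{j+1}$ be the complete Bell polynomials. Write $P(r;\lambda)(t)=\sum_{k=0}^{n-1}\lambda^k r_k(t)$, write $\partial_x^kP(r;\lambda)$ for the $k$-th derivative of $x\mapsto P(r(t);x)$ at $x=\lambda$, and put $$\mathcal L(t,z)=\sum_{k=1}^{n-1}\frac1{k!}\,\partial_x^kP(r;\lambda)(t)\,z^{(k-1)}(t),$$ $$\mathcal F(t,z,\dots,z^{(n-2)})=\sum_{i=2}^{n}\sum_{j=0}^{n-i}\binom{i+j}{j}(a_{i+j}+r_{i+j}(t))\,\lambda^j\big(B_i(z,z',\dots,z^{(i-1)})-z^{(i-1)}\big).$$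 Theorem. Assume that the integrals defining $G_{\gamma_j}[P(r;\lambda)](t)$, $t\ge t_0$, converge for $j=1,\dots,n-1$, and that $$\sum_{i=0}^{n-2}\big|G[P(r;\lambda)]^{(i)}(t)\big|\to 0\qquad(t\to\infty).\tag{2}$$ Set $\theta=-G[P(r;\lambda)]$ and $R(t,\theta)=\mathcal L(t,\theta)+\mathcal F(t,\theta,\theta',\dots,\theta^{(n-2)})$. Suppose that $R(\cdot,\theta)\in L^1[t_0,\infty)$ and that, for some $0<\beta<\min_j|\alpha_j|$, $$\sum_{j=1}^{n-1}\sum_{k=1}^{n-1}\frac{\tilde\alpha_j}{|\Gamma_j|\,k!}\;\sup_{t\ge t_0}I_{\alpha_j-\operatorname{sgn}(\alpha_j)\beta}\big[\partial_x^kP(r;\lambda)\big](t)<\frac12 .\tag{3}$$ Then there is a solution $y_\lambda$ of (1) on $[t_0,\infty)$, non-zero for all large $t$, such that $$\lim_{t\to\infty}\frac{y_\lambda^{(i)}(t)}{y_\lambda(t)}=\lambda^i,\qquad i=1,\dots,n-1,$$ and $$y_\lambda(t)=[1+\varepsilon(t)]\,e^{\lambda(t-t_0)}\exp\Big(-\sum_{j=1}^{n-1}\frac{1}{\Gamma_j\gamma_j}G_{\gamma_j}[P(r;\lambda)](t)+(-1)^n\prod_{k=1}^{n-1}(\lambda_k-\lambda)^{-1}\int_{t_0}^tP(r;\lambda)(s)\,ds\Big),$$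 where, as $t\to\infty$, $\varepsilon(t)=O\Big(\int_t^\infty (I_\beta+I_{-\beta})[R(\cdot,\theta)](s)\,ds\Big)$; here $\int_{t_0}^\infty (I_\beta+I_{-\beta})[R(\cdot,\theta)](s)\,ds<\infty$. -/

import Mathlib

open MeasureTheory Set Filter Topology Polynomial
open scoped ENNReal Nat

namespace PoincarePerron

noncomputable section

/-- The polynomial `P(c;x) = ∑_{i=0}^{n} c_i x^i`. -/
def charPoly (n : ℕ) (c : ℕ → ℂ) : ℂ[X] :=
  ∑ i ∈ Finset.range (n + 1), Polynomial.monomial i (c i)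

/-- The value at `x = l` of the `k`-th derivative with respect to `x` of
`P(r(t);x) = ∑_{i=0}^{n} r_i(t) x^i`; for `k = 0` this is `P(r(t);l)`. -/
def pertDeriv (n : ℕ) (r : ℕ → ℝ → ℂ) (l : ℂ) (k : ℕ) (t : ℝ) : ℂ :=
  ((Polynomial.derivative^[k]) (charPoly n (fun i => r i t))).eval l

/-- Complete Bell polynomials: `bell x i = B_i(x_1, …, x_i)`, where `x j` stands for `x_{j+1}`. -/
def bell (x : ℕ → ℂ) : ℕ → ℂ
  | 0 => 1
  | i + 1 => ∑ j : Fin (i + 1), (i.choose (j : ℕ) : ℂ) * bell x (i - (j : ℕ)) * x j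
  termination_by i => i
  decreasing_by omega

/-- The kernel `g_ω(t,s)`: it is `-sgn(Re ω) e^{ω(t-s)}` if `sgn(Re ω)(t-s) < 0`, else `0`. -/
def greenKernel (ω : ℂ) (t s : ℝ) : ℂ :=
  if Real.sign ω.re * (t - s) < 0 then
    -((Real.sign ω.re : ℝ) : ℂ) * Complex.exp (ω * ((t : ℂ) - (s : ℂ)))
  else 0

/-- The integral `∫_{t₀}^∞ g_ω(t,s) f(s) ds` converges for every `t ≥ t₀`, as the limit of
`∫_{t₀}^T` as `T → ∞`. -/
def GreenConverges (t₀ : ℝ) (ω : ℂ) (f : ℝ → ℂ) : Prop :=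
  ∀ t, t₀ ≤ t → ∃ v : ℂ, Tendsto (fun T : ℝ => ∫ s in t₀..T, greenKernel ω t s * f s) atTop (𝓝 v)

/-- `G_ω[f](t) = ∫_{t₀}^∞ g_ω(t,s) f(s) ds = lim_{T → ∞} ∫_{t₀}^T g_ω(t,s) f(s) ds`. -/
def greenOmega (t₀ : ℝ) (ω : ℂ) (f : ℝ → ℂ) (t : ℝ) : ℂ :=
  limUnder atTop (fun T : ℝ => ∫ s in t₀..T, greenKernel ω t s * f s)

/-- `I_ω[f](t) = ∫_{t₀}^∞ |g_ω(t,s) f(s)| ds`, with values in `[0,∞]`. -/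
def absGreen (t₀ : ℝ) (ω : ℂ) (f : ℝ → ℂ) (t : ℝ) : ℝ≥0∞ :=
  ∫⁻ s in Ici t₀, ‖greenKernel ω t s * f s‖ₑ

/-- `Γ_j = ∏_{k ≠ j} (γ_j - γ_k)`. -/
def bigGamma {m : ℕ} (γ : Fin m → ℂ) (j : Fin m) : ℂ :=
  ∏ k ∈ Finset.univ.erase j, (γ j - γ k)

/-- `α̃_j = ∑_{i=0}^{m-1} |γ_j|^i`, where `m` is the number of the `γ`'s. -/
def alphaTilde {m : ℕ} (γ : Fin m → ℂ) (j : Fin m) : ℝ :=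
  ∑ i ∈ Finset.range m, ‖γ j‖ ^ i

/-- The Green operator `G[f] = ∑_j Γ_j⁻¹ G_{γ_j}[f]`. -/
def greenOp {m : ℕ} (t₀ : ℝ) (γ : Fin m → ℂ) (f : ℝ → ℂ) (t : ℝ) : ℂ :=
  ∑ j, (1 / bigGamma γ j) * greenOmega t₀ (γ j) f t

/-- The jet `(z, z', z'', …)` at `t` of a function on `[t₀,∞)`. -/
def jet (t₀ : ℝ) (z : ℝ → ℂ) (t : ℝ) (i : ℕ) : ℂ :=
  iteratedDerivWithin i z (Ici t₀) t

/-- `ℒ(t,Z) = ∑_{k=1}^{n-1} (1/k!) ∂_x^k P(r(t);l) Z_{k-1}`. -/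
def linTerm (n : ℕ) (r : ℕ → ℝ → ℂ) (l : ℂ) (t : ℝ) (Z : ℕ → ℂ) : ℂ :=
  ∑ k ∈ Finset.Icc 1 (n - 1), (1 / (k ! : ℂ)) * pertDeriv n r l k t * Z (k - 1)

/-- `ℱ(t,Z) = ∑_{i=2}^{n} ∑_{j=0}^{n-i} C(i+j,j) (a_{i+j} + r_{i+j}(t)) l^j (B_i(Z) - Z_{i-1})`.
As `B_i(x_1,…,x_i) - x_i` does not contain `x_i`, only `Z_0, …, Z_{n-2}` matter. -/
def nonlinTerm (n : ℕ) (a : ℕ → ℂ) (r : ℕ → ℝ → ℂ) (l : ℂ) (t : ℝ) (Z : ℕ → ℂ) : ℂ :=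
  ∑ i ∈ Finset.Icc 2 n, ∑ j ∈ Finset.range (n - i + 1),
    ((i + j).choose j : ℂ) * (a (i + j) + r (i + j) t) * l ^ j * (bell Z i - Z (i - 1))

/-- `R(t,z) = ℒ(t,z) + ℱ(t,z,z',…,z^{(n-2)})` along a function `z` on `[t₀,∞)`. -/
def remTerm (n : ℕ) (a : ℕ → ℂ) (r : ℕ → ℝ → ℂ) (l : ℂ) (t₀ : ℝ) (z : ℝ → ℂ) (t : ℝ) : ℂ :=
  linTerm n r l t (jet t₀ z t) + nonlinTerm n a r l t (jet t₀ z t)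

/-- `y` solves `y^{(n)} + ∑_{i<n} (a_i + r_i(t)) y^{(i)} = 0` on `[t₀,∞)` in the sense of
Carathéodory (the coefficients being only locally integrable): `y` is of class `C^{n-1}`,
`y^{(n-1)}` is locally absolutely continuous and the equation holds almost everywhere. -/
structure IsSolution (n : ℕ) (a : ℕ → ℂ) (r : ℕ → ℝ → ℂ) (t₀ : ℝ) (y : ℝ → ℂ) : Prop where
  contDiffOn : ContDiffOn ℝ ((n - 1 : ℕ) : WithTop ℕ∞) y (Ici t₀)
  absCont : ∀ T, t₀ ≤ T →
    AbsolutelyContinuousOnInterval (iteratedDerivWithin (n - 1) y (Ici t₀)) t₀ T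
  equation : ∀ᵐ t ∂(volume.restrict (Ici t₀)),
    iteratedDerivWithin n y (Ici t₀) t +
      ∑ i ∈ Finset.range n, (a i + r i t) * iteratedDerivWithin i y (Ici t₀) t = 0

end

end PoincarePerron

namespace PoincarePerron

/-! Write $y=e^{\lambda t}u$ with $u=\exp\int z$. Then $u^{(k)}/u=B_k(z,z',\dots)$, and the factor
$e^{\lambda t}$ shifts $P(a;x)$ to $P(a;x+\lambda)$. The linear equation becomes the Riccati type
equation $Lz+P(r;\lambda)+\mathcal L(t,z)+\mathcal F(t,z,\dots)=0$ (`sum_mul_binomialShift_bell`),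
where $L$ has constant coefficients and characteristic polynomial $P(a;x+\lambda)/x$, whose roots
are the $\gamma_j$. Since $\Re\gamma_j\ne0$, $L$ is inverted by $G$. Put $z=\theta+u$, with $u$ from
now on the correction to $\theta$: it suffices to solve $u=-G[R(\cdot,\theta+u)]$ on some
$[T,\infty)$, with $G$ integrating from $T$.

This is a contraction for large $T$ (`exists_jet_correction`). The nonlinearity $\mathcal F$ has no
linear part, so on a small ball its Lipschitz constant is small relative to the coefficients
(`exists_norm_bell_sub_le`), and (3) controls $\mathcal L$. The pointwise bound comes from the
weight $\rho=(I_\beta+I_{-\beta})[R(\cdot,\theta)]$, which is $\int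
e^{-\beta|t-s|}|R(s,\theta)|\,ds$. It changes by a factor of at most $e^{\beta|t-s|}$ between $s$
and $t$, so integrating $\rho$ against the kernel of $\gamma_j$ costs only the replacement of
$\alpha_j$ by $\alpha_j-\operatorname{sgn}(\alpha_j)\beta$ (`enorm_greenKernel_mul_expAverage_le`),
which is the exponent in (3). Hence $|u|\le M\rho$.

As $R(\cdot,\theta)\in L^1$, $\rho$ is integrable and tends to $0$. So the jet of $z$ tends to $0$,
which gives the limits $\lambda^i$, and $1+\varepsilon(t)=\exp(-\int_t^\infty u)$ for $t\ge T$. The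
explicit exponent is an antiderivative of $\theta$ (`isPrimitiveOn_exponent`). Backward solvability
of the linear equation carries $y$ from $[T,\infty)$ to $[t_0,\infty)$
(`exists_isSolution_extension`). -/

/-! ### Calculus of primitives of locally integrable functions. -/

theorem absolutelyContinuousOnInterval_const {E : Type*} [PseudoMetricSpace E] (c : E) (a b : ℝ) :
    AbsolutelyContinuousOnInterval (fun _ : ℝ => c) a b :=
  (LipschitzWith.const c).lipschitzOnWith.absolutelyContinuousOnInterval

theorem _root_.AbsolutelyContinuousOnInterval.congr_on {E : Type*} [PseudoMetricSpace E]
    {f g : ℝ → E} {a b : ℝ} (hf : AbsolutelyContinuousOnInterval f a b)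
    (h : ∀ x ∈ uIcc a b, f x = g x) : AbsolutelyContinuousOnInterval g a b := by
  rw [absolutelyContinuousOnInterval_iff] at hf ⊢
  intro ε hε
  obtain ⟨δ, hδ, H⟩ := hf ε hε
  refine ⟨δ, hδ, fun E hE hE2 => ?_⟩
  convert H E hE hE2 using 1
  refine Finset.sum_congr rfl fun i hi => ?_
  rw [h _ (hE.1 i hi).1, h _ (hE.1 i hi).2]

theorem absolutelyContinuousOnInterval_integral_complex {f : ℝ → ℂ} {a b : ℝ}
    (h : IntervalIntegrable f volume a b) :
    AbsolutelyContinuousOnInterval (fun x => ∫ v in a..x, f v) a b := by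
  have hre : IntervalIntegrable (fun x => (f x).re) volume a b := ⟨h.1.re, h.2.re⟩
  have him : IntervalIntegrable (fun x => (f x).im) volume a b := ⟨h.1.im, h.2.im⟩
  have h1 := (hre.absolutelyContinuousOnInterval_intervalIntegral (c := a) (by simp)).smul
    (absolutelyContinuousOnInterval_const (1 : ℂ) a b)
  have h2 := (him.absolutelyContinuousOnInterval_intervalIntegral (c := a) (by simp)).smul
    (absolutelyContinuousOnInterval_const Complex.I a b)
  refine (h1.add h2).congr_on fun x hx => ?_
  have hx' : IntervalIntegrable f volume a x := h.mono_set (uIcc_subset_uIcc_left hx)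
  have e1 : (∫ v in a..x, (f v).re) = (∫ v in a..x, f v).re :=
    Complex.reCLM.intervalIntegral_comp_comm hx'
  have e2 : (∫ v in a..x, (f v).im) = (∫ v in a..x, f v).im :=
    Complex.imCLM.intervalIntegral_comp_comm hx'
  simp only [Pi.add_apply, Pi.smul_apply', e1, e2, Complex.real_smul, mul_one]
  exact Complex.re_add_im _

theorem _root_.MeasureTheory.LocallyIntegrableOn.intervalIntegrable_of_Ici {E : Type*}
    [NormedAddCommGroup E] {f : ℝ → E} {a x y : ℝ}
    (hf : LocallyIntegrableOn f (Ici a)) (hx : a ≤ x) (hy : a ≤ y) :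
    IntervalIntegrable f volume x y := by
  rw [intervalIntegrable_iff]
  refine (hf.integrableOn_compact_subset (t := uIcc x y) ?_ isCompact_uIcc).mono_set
    uIoc_subset_uIcc
  intro s hs
  exact (le_min hx hy).trans hs.1

/-- `F` is a primitive of the locally integrable function `f` on `[a,∞)`. -/
structure IsPrimitiveOn (F f : ℝ → ℂ) (a : ℝ) : Prop where
  locInt : LocallyIntegrableOn f (Ici a)
  eq : ∀ t, a ≤ t → F t = F a + ∫ s in a..t, f s

namespace IsPrimitiveOn

variable {F G f g : ℝ → ℂ} {a b : ℝ}

theorem absolutelyContinuousOnInterval (h : IsPrimitiveOn F f a) (hb : a ≤ b) :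
    AbsolutelyContinuousOnInterval F a b := by
  have := (absolutelyContinuousOnInterval_const (F a) a b).add
    (absolutelyContinuousOnInterval_integral_complex (h.locInt.intervalIntegrable_of_Ici le_rfl hb))
  refine this.congr_on fun x hx => ?_
  rw [uIcc_of_le hb] at hx
  simp [h.eq x hx.1]

theorem continuousOn (h : IsPrimitiveOn F f a) : ContinuousOn F (Ici a) := by
  intro x hx
  have h1 := (h.absolutelyContinuousOnInterval (b := x + 1) (by linarith [mem_Ici.1 hx])).continuousOn
  rw [uIcc_of_le (by linarith [mem_Ici.1 hx])] at h1
  refine (h1 x ⟨hx, by linarith⟩).mono_of_mem_nhdsWithin ?_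
  rw [← Ici_inter_Iic]
  exact inter_mem_nhdsWithin _ (Iic_mem_nhds (by linarith))

theorem sub_eq (h : IsPrimitiveOn F f a) {x y : ℝ} (hx : a ≤ x) (hy : a ≤ y) :
    F y - F x = ∫ s in x..y, f s := by
  rw [h.eq x hx, h.eq y hy, ← intervalIntegral.integral_add_adjacent_intervals
    (h.locInt.intervalIntegrable_of_Ici le_rfl hx) (h.locInt.intervalIntegrable_of_Ici hx hy)]
  ring

theorem ae_hasDerivAt (h : IsPrimitiveOn F f a) : ∀ᵐ t, a < t → HasDerivAt F (f t) t := by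
  have h1 : ∀ k : ℕ, ∀ᵐ t, t ∈ uIcc a (a + k) → ∀ c ∈ uIcc a (a + k),
      HasDerivAt (fun x => ∫ s in c..x, f s) (f t) t := fun k =>
    IntervalIntegrable.ae_hasDerivAt_integral
      (h.locInt.intervalIntegrable_of_Ici le_rfl (by simp))
  filter_upwards [ae_all_iff.2 h1] with t ht hat
  obtain ⟨k, hk⟩ := exists_nat_ge (t - a)
  have h2 := ht k (by rw [uIcc_of_le (by simp)]; exact ⟨hat.le, by linarith⟩) a (by simp)
  refine (h2.const_add (F a)).congr_of_eventuallyEq ?_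
  filter_upwards [Ioi_mem_nhds hat] with s hs using h.eq s (le_of_lt hs)

/-- `F` minus the integral of `f` is absolutely continuous with derivative zero almost everywhere,
hence constant. This is what makes the product rule available for merely integrable derivatives. -/
theorem of_ae (hf : LocallyIntegrableOn f (Ici a))
    (hac : ∀ b, a ≤ b → AbsolutelyContinuousOnInterval F a b)
    (hd : ∀ᵐ t, a < t → HasDerivAt F (f t) t) : IsPrimitiveOn F f a := by
  refine ⟨hf, fun t ht => ?_⟩
  have hP : IsPrimitiveOn (fun x => ∫ s in a..x, f s) f a := ⟨hf, fun t ht => by simp⟩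
  have h1 := (hac t ht).sub (hP.absolutelyContinuousOnInterval ht)
  obtain ⟨C, hC⟩ := h1.const_of_ae_hasDerivAt_zero (by
    have hne : ∀ᵐ x : ℝ, x ≠ a := by simp [ae_iff, measure_singleton]
    filter_upwards [hd, hP.ae_hasDerivAt, hne] with x hx1 hx2 hx3 hx
    rw [uIcc_of_le ht] at hx
    have hax : a < x := lt_of_le_of_ne hx.1 hx3.symm
    simpa using (hx1 hax).sub (hx2 hax))
  have e1 := hC a (by simp)
  have e2 := hC t (by simp)
  simp only [Pi.sub_apply, intervalIntegral.integral_same, sub_zero] at e1 e2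
  rw [e1, ← e2]; ring

theorem congr (h : IsPrimitiveOn F f a) (hF : ∀ t, a ≤ t → G t = F t)
    (hfg : ∀ t, a ≤ t → g t = f t) : IsPrimitiveOn G g a := by
  refine ⟨h.locInt.congr ?_, fun t ht => ?_⟩
  · filter_upwards [ae_restrict_mem measurableSet_Ici] with t ht using (hfg t ht).symm
  · rw [hF t ht, hF a le_rfl, h.eq t ht]
    congr 1
    refine intervalIntegral.integral_congr fun s hs => ?_
    rw [uIcc_of_le ht] at hs
    exact (hfg s hs.1).symm

theorem mono (h : IsPrimitiveOn F f a) (hab : a ≤ b) : IsPrimitiveOn F f b :=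
  ⟨h.locInt.mono_set (Ici_subset_Ici.2 hab), fun t ht => by
    rw [← h.sub_eq hab (hab.trans ht)]; ring⟩

theorem const (c : ℂ) (a : ℝ) : IsPrimitiveOn (fun _ => c) (fun _ => 0) a :=
  ⟨locallyIntegrableOn_zero, fun t _ => by simp⟩

theorem add (hF : IsPrimitiveOn F f a) (hG : IsPrimitiveOn G g a) :
    IsPrimitiveOn (fun t => F t + G t) (fun t => f t + g t) a :=
  ⟨hF.locInt.add hG.locInt, fun t ht => by
    rw [hF.eq t ht, hG.eq t ht, intervalIntegral.integral_add
      (hF.locInt.intervalIntegrable_of_Ici le_rfl ht) (hG.locInt.intervalIntegrable_of_Ici le_rfl ht)]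
    ring⟩

theorem const_mul (hF : IsPrimitiveOn F f a) (c : ℂ) :
    IsPrimitiveOn (fun t => c * F t) (fun t => c * f t) a :=
  ⟨hF.locInt.smul c, fun t ht => by
    rw [hF.eq t ht, intervalIntegral.integral_const_mul]; ring⟩

theorem sum {ι : Type*} (s : Finset ι) {F f : ι → ℝ → ℂ} (h : ∀ i ∈ s, IsPrimitiveOn (F i) (f i) a) :
    IsPrimitiveOn (fun t => ∑ i ∈ s, F i t) (fun t => ∑ i ∈ s, f i t) a := by
  classical
  induction s using Finset.induction_on with
  | empty => simpa using const 0 a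
  | insert i s hi ih =>
    simp only [Finset.sum_insert hi]
    exact (h i (by simp)).add (ih fun j hj => h j (by simp [hj]))

theorem mul (hF : IsPrimitiveOn F f a) (hG : IsPrimitiveOn G g a) :
    IsPrimitiveOn (fun t => F t * G t) (fun t => f t * G t + F t * g t) a := by
  refine of_ae ?_ (fun b hb => (hF.absolutelyContinuousOnInterval hb).smul
    (hG.absolutelyContinuousOnInterval hb)) ?_
  · exact (hF.locInt.mul_continuousOn hG.continuousOn isClosed_Ici.isLocallyClosed).add
      (hG.locInt.continuousOn_mul hF.continuousOn isClosed_Ici.isLocallyClosed)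
  · filter_upwards [hF.ae_hasDerivAt, hG.ae_hasDerivAt] with t h1 h2 ht using (h1 ht).mul (h2 ht)

theorem hasDerivWithinAt (hF : IsPrimitiveOn F f a) (hf : ContinuousOn f (Ici a)) {t : ℝ}
    (ht : a ≤ t) : HasDerivWithinAt F (f t) (Ici a) t := by
  -- Freezing `f` to the left of `a` gives a globally continuous integrand, so the endpoint `t = a`
  -- needs no separate treatment.
  have hc : Continuous (fun s => f (max s a)) :=
    hf.comp_continuous (by fun_prop) fun s => mem_Ici.2 (le_max_right _ _)
  have h1 := (intervalIntegral.integral_hasDerivAt_right (hc.intervalIntegrable a t)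
    hc.stronglyMeasurable.stronglyMeasurableAtFilter hc.continuousAt).const_add (F a)
  rw [max_eq_left ht] at h1
  have key : ∀ x, a ≤ x → F x = F a + ∫ s in a..x, f (max s a) := fun x hx => by
    rw [hF.eq x hx]
    congr 1
    refine intervalIntegral.integral_congr fun s hs => ?_
    rw [uIcc_of_le hx] at hs
    simp [max_eq_left hs.1]
  exact h1.hasDerivWithinAt.congr (fun x hx => key x hx) (key t ht)

theorem of_hasDerivWithinAt (hf : ContinuousOn f (Ici a))
    (h : ∀ t, a ≤ t → HasDerivWithinAt F (f t) (Ici a) t) : IsPrimitiveOn F f a := by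
  refine ⟨hf.locallyIntegrableOn measurableSet_Ici, fun t ht => ?_⟩
  rw [intervalIntegral.integral_eq_sub_of_hasDerivAt_of_le ht (f := F)]
  · ring
  · exact fun s hs => (h s hs.1).continuousWithinAt.mono Icc_subset_Ici_self
  · exact fun s hs => (h s hs.1.le).hasDerivAt (Ici_mem_nhds hs.1)
  · exact (hf.mono (by rw [uIcc_of_le ht]; exact Icc_subset_Ici_self)).intervalIntegrable

end IsPrimitiveOn

/-! ### Backward solvability of Carathéodory equations. -/

/-- With $K=\int_a\kappa$, the monotone function $-e^{-2K}/2$ has the integrand as its derivative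
almost everywhere, and the derivative of a monotone function integrates to at most the increment.
The factor $1/2$ becomes a contraction constant independent of the size of $\int\kappa$. -/
theorem integral_mul_exp_neg_primitive_le {κ : ℝ → ℝ} (hκ0 : ∀ s, 0 ≤ κ s) {a b t : ℝ}
    (hκ : IntervalIntegrable κ volume a b) (ht : t ∈ Icc a b) :
    IntervalIntegrable (fun s => κ s * Real.exp (-(2 * ∫ u in a..s, κ u))) volume t b ∧
    ∫ s in t..b, κ s * Real.exp (-(2 * ∫ u in a..s, κ u)) ≤
      Real.exp (-(2 * ∫ u in a..t, κ u)) / 2 := by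
  have hab : a ≤ b := ht.1.trans ht.2
  set ψ : ℝ → ℝ := fun s => -Real.exp (-(2 * ∫ u in a..s, κ u)) / 2 with hψ
  have hsub : ∀ x ∈ Icc a b, ∀ y ∈ Icc a b, IntervalIntegrable κ volume x y := fun x hx y hy =>
    hκ.mono_set (by rw [uIcc_of_le hab]; exact uIcc_subset_Icc hx hy)
  have hmono : MonotoneOn ψ (uIcc t b) := by
    intro x hx y hy hxy
    rw [uIcc_of_le ht.2] at hx hy
    have hx' : x ∈ Icc a b := ⟨ht.1.trans hx.1, hx.2⟩
    have hy' : y ∈ Icc a b := ⟨ht.1.trans hy.1, hy.2⟩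
    have h1 := intervalIntegral.integral_add_adjacent_intervals
      (hsub a ⟨le_rfl, hab⟩ x hx') (hsub x hx' y hy')
    have h2 : 0 ≤ ∫ u in x..y, κ u := intervalIntegral.integral_nonneg hxy fun u _ => hκ0 u
    have : Real.exp (-(2 * ∫ u in a..y, κ u)) ≤ Real.exp (-(2 * ∫ u in a..x, κ u)) :=
      Real.exp_le_exp.2 (by linarith)
    simp only [hψ]; linarith
  have hd : ∀ᵐ s, s ∈ uIcc t b → deriv ψ s = κ s * Real.exp (-(2 * ∫ u in a..s, κ u)) := by
    filter_upwards [hκ.ae_hasDerivAt_integral] with s hs hst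
    rw [uIcc_of_le ht.2] at hst
    have h1 := hs (by rw [uIcc_of_le hab]; exact ⟨ht.1.trans hst.1, hst.2⟩) a (by simp)
    have h2 := (((h1.const_mul 2).neg.exp).neg.div_const 2).deriv
    simp only [hψ]
    refine h2.trans ?_
    simp only [Pi.neg_apply]; ring
  have hd' : ∀ᵐ s, s ∈ uIoc t b → deriv ψ s = κ s * Real.exp (-(2 * ∫ u in a..s, κ u)) := by
    filter_upwards [hd] with s hs h using hs (uIoc_subset_uIcc h)
  constructor
  · refine hmono.intervalIntegrable_deriv.congr_ae ?_
    rw [Filter.EventuallyEq, ae_restrict_iff' measurableSet_uIoc]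
    exact hd'
  · rw [← intervalIntegral.integral_congr_ae hd']
    have h3 := hmono.intervalIntegral_deriv_mem_uIcc
    have h4 : ψ t ≤ ψ b := hmono (by simp) (by simp) ht.2
    rw [uIcc_of_le (by linarith)] at h3
    have h5 : ψ b ≤ 0 := by simp only [hψ]; have := Real.exp_pos (-(2 * ∫ u in a..b, κ u)); linarith
    have h6 : ψ t = -(Real.exp (-(2 * ∫ u in a..t, κ u)) / 2) := by simp only [hψ]; ring
    linarith [h3.2]

theorem continuous_integral_projection {E : Type*} [NormedAddCommGroup E] [NormedSpace ℝ E]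
    {a b : ℝ} (hab : a ≤ b) {f : ℝ → E} (hf : IntervalIntegrable f volume a b) :
    Continuous (fun t => ∫ u in a..max a (min t b), f u) := by
  have := intervalIntegral.continuousOn_primitive_interval (μ := volume) (f := f) (a := a) (b := b)
    (by rw [uIcc_of_le hab]; exact (intervalIntegrable_iff_integrableOn_Icc_of_le hab).1 hf)
  rw [uIcc_of_le hab] at this
  exact this.comp_continuous (by fun_prop) fun t =>
    ⟨le_max_left _ _, max_le hab (min_le_right _ _)⟩

/-- Backward existence for Carathéodory equations with integrable Lipschitz constant. -/
theorem exists_continuous_eq_sub_integral {E : Type*} [NormedAddCommGroup E] [NormedSpace ℝ E]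
    [CompleteSpace E] {a b : ℝ} (hab : a ≤ b) (F : ℝ → E → E) (κ : ℝ → ℝ) (hκ0 : ∀ s, 0 ≤ κ s)
    (hκ : IntervalIntegrable κ volume a b)
    (hF : ∀ U : ℝ → E, Continuous U → IntervalIntegrable (fun s => F s (U s)) volume a b)
    (hL : ∀ s x y, ‖F s x - F s y‖ ≤ κ s * ‖x - y‖) (y₀ : E) :
    ∃ U : ℝ → E, Continuous U ∧ ∀ t ∈ Icc a b, U t = y₀ - ∫ s in t..b, F s (U s) := by
  -- Clamping time to `[a, b]` lets the argument run in the bounded continuous functions on the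
  -- whole line.
  set π : ℝ → ℝ := fun t => max a (min t b) with hπ
  have hπc : Continuous π := by fun_prop
  have hπm : ∀ t, π t ∈ Icc a b := fun t => ⟨le_max_left _ _, max_le hab (min_le_right _ _)⟩
  have hπid : ∀ t ∈ Icc a b, π t = t := fun t ht => by simp [hπ, ht.1, ht.2]
  -- A Bielecki weight: it decreases in `t` because the equation is integrated backwards from `b`,
  -- and $w(t)^{-1}\int_t^b\kappa w\le 1/2$.
  set w : ℝ → ℝ := fun t => Real.exp (-(2 * ∫ u in a..π t, κ u)) with hw
  have hwc : Continuous w := by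
    have : Continuous fun t => ∫ u in a..π t, κ u := continuous_integral_projection hab hκ
    fun_prop
  have hw0 : ∀ t, 0 < w t := fun t => Real.exp_pos _
  -- the operator acting on `V = U / w`
  have hint : ∀ V : BoundedContinuousFunction ℝ E, IntervalIntegrable (fun s => F s (w s • V s)) volume a b :=
    fun V => hF _ (hwc.smul V.continuous)
  have hsub : ∀ (V : BoundedContinuousFunction ℝ E) (t : ℝ), IntervalIntegrable (fun s => F s (w s • V s)) volume (π t) b :=
    fun V t => (hint V).mono_set (by
      rw [uIcc_of_le hab, uIcc_of_le (hπm t).2]; exact Icc_subset_Icc_left (hπm t).1)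
  set Ψ : BoundedContinuousFunction ℝ E → ℝ → E :=
    fun V t => (w t)⁻¹ • (y₀ - ∫ s in π t..b, F s (w s • V s)) with hΨ
  have hΨc : ∀ V, Continuous (Ψ V) := by
    intro V
    have h1 : ∀ t, ∫ s in π t..b, F s (w s • V s) =
        (∫ s in a..b, F s (w s • V s)) - ∫ s in a..π t, F s (w s • V s) := fun t => by
      have h0 : IntervalIntegrable (fun s => F s (w s • V s)) volume a (π t) :=
        (hint V).mono_set (by
          rw [uIcc_of_le hab, uIcc_of_le (hπm t).1]; exact Icc_subset_Icc_right (hπm t).2)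
      rw [← intervalIntegral.integral_add_adjacent_intervals h0 (hsub V t)]
      abel
    have h2 : Continuous fun t => ∫ s in a..π t, F s (w s • V s) :=
      continuous_integral_projection hab (hint V)
    simp only [hΨ, h1]
    exact (hwc.inv₀ fun t => (hw0 t).ne').smul (continuous_const.sub (continuous_const.sub h2))
  have hΨb : ∀ V, ∃ C, ∀ t, ‖Ψ V t‖ ≤ C := by
    intro V
    obtain ⟨C, hC⟩ := (isCompact_Icc (a := a) (b := b)).exists_bound_of_continuousOn
      (hΨc V).continuousOn
    refine ⟨C, fun t => ?_⟩
    have : Ψ V t = Ψ V (π t) := by simp only [hΨ, hw, hπid _ (hπm t)]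
    rw [this]; exact hC _ (hπm t)
  choose C hC using hΨb
  set Φ : BoundedContinuousFunction ℝ E → BoundedContinuousFunction ℝ E := fun V =>
    BoundedContinuousFunction.ofNormedAddCommGroup (Ψ V) (hΨc V) (C V) (hC V) with hΦ
  have hcon : ContractingWith (1 / 2) Φ := by
    refine ⟨by norm_num, LipschitzWith.of_dist_le_mul fun V V' => ?_⟩
    refine (BoundedContinuousFunction.dist_le (by positivity)).2 fun t => ?_
    have e : Φ V t - Φ V' t =
        (w t)⁻¹ • -(∫ s in π t..b, (F s (w s • V s) - F s (w s • V' s))) := by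
      rw [intervalIntegral.integral_sub (hsub V t) (hsub V' t)]
      simp only [hΦ, hΨ, BoundedContinuousFunction.coe_ofNormedAddCommGroup, ← smul_sub]
      congr 1; abel
    obtain ⟨i1, i2⟩ := integral_mul_exp_neg_primitive_le hκ0 hκ (hπm t)
    have hb : ‖∫ s in π t..b, (F s (w s • V s) - F s (w s • V' s))‖ ≤
        ∫ s in π t..b, dist V V' * (κ s * Real.exp (-(2 * ∫ u in a..s, κ u))) := by
      refine intervalIntegral.norm_integral_le_of_norm_le (hπm t).2 ?_ (i1.const_mul _)
      filter_upwards with s hs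
      have hs' : w s = Real.exp (-(2 * ∫ u in a..s, κ u)) := by
        simp only [hw]; rw [hπid s ⟨(hπm t).1.trans hs.1.le, hs.2⟩]
      rw [← hs']
      refine (hL s _ _).trans ?_
      rw [← smul_sub, norm_smul, Real.norm_of_nonneg (hw0 s).le, ← dist_eq_norm]
      have := V.dist_coe_le_dist (g := V') s
      have h3 := mul_le_mul_of_nonneg_left this (mul_nonneg (hκ0 s) (hw0 s).le)
      linarith
    rw [intervalIntegral.integral_const_mul] at hb
    have hwt : Real.exp (-(2 * ∫ u in a..π t, κ u)) = w t := rfl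
    rw [hwt] at i2
    rw [dist_eq_norm, e, norm_smul, norm_neg, norm_inv, Real.norm_of_nonneg (hw0 t).le,
      inv_mul_le_iff₀ (hw0 t)]
    refine hb.trans ((mul_le_mul_of_nonneg_left i2 dist_nonneg).trans (le_of_eq ?_))
    push_cast; ring
  obtain ⟨V, hV, -⟩ := hcon.exists_fixedPoint 0 (edist_ne_top _ _)
  refine ⟨fun t => w t • V t, hwc.smul V.continuous, fun t ht => ?_⟩
  have h1 : V t = Ψ V t := by
    conv_lhs => rw [← hV.eq]
    rfl
  simp only []
  rw [h1]
  simp only [hΨ]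
  rw [smul_inv_smul₀ (hw0 t).ne', hπid t ht]

/-! ### The linear equation as a first order system, and its extension to the left. -/

theorem intervalIntegrable_fun_sum {ι E : Type*} [NormedAddCommGroup E] {s : Finset ι}
    {f : ι → ℝ → E} {a b : ℝ} (h : ∀ i ∈ s, IntervalIntegrable (f i) volume a b) :
    IntervalIntegrable (fun t => ∑ i ∈ s, f i t) volume a b := by
  simpa only [← Finset.sum_apply] using! IntervalIntegrable.sum s h

theorem iteratedDerivWithin_eq_of_hasDerivWithinAt {Y : ℕ → ℝ → ℂ} {a : ℝ} {N : ℕ}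
    (h : ∀ i < N, ∀ t, a ≤ t → HasDerivWithinAt (Y i) (Y (i + 1) t) (Ici a) t) :
    ∀ i ≤ N, ∀ t, a ≤ t → iteratedDerivWithin i (Y 0) (Ici a) t = Y i t := by
  intro i
  induction i with
  | zero => intro _ t _; simp
  | succ i ih =>
    intro hi t ht
    rw [iteratedDerivWithin_succ, derivWithin_congr (s := Ici a) (fun s hs => ih (by omega) s hs)
      (ih (by omega) t ht)]
    exact (h i (by omega) t ht).derivWithin (uniqueDiffOn_Ici a t ht)

theorem contDiffOn_of_hasDerivWithinAt {Y : ℕ → ℝ → ℂ} {a : ℝ} {N : ℕ}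
    (h : ∀ i < N, ∀ t, a ≤ t → HasDerivWithinAt (Y i) (Y (i + 1) t) (Ici a) t)
    (hN : ContinuousOn (Y N) (Ici a)) :
    ContDiffOn ℝ (N : WithTop ℕ∞) (Y 0) (Ici a) := by
  have key := iteratedDerivWithin_eq_of_hasDerivWithinAt h
  refine (contDiffOn_nat_iff_continuousOn_differentiableOn_deriv (uniqueDiffOn_Ici a)).2 ⟨?_, ?_⟩
  · intro m hm
    refine ContinuousOn.congr ?_ (fun t ht => key m hm t ht)
    rcases hm.lt_or_eq with hm' | rfl
    · exact fun t ht => (h m hm' t ht).continuousWithinAt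
    · exact hN
  · intro m hm
    refine DifferentiableOn.congr ?_ (fun t ht => key m hm.le t ht)
    exact fun t ht => (h m hm t ht).differentiableWithinAt

theorem hasDerivWithinAt_of_isPrimitiveOn_succ {Y : ℕ → ℝ → ℂ} {a : ℝ} {N : ℕ}
    (h : ∀ i < N, IsPrimitiveOn (Y i) (Y (i + 1)) a) (hN : ContinuousOn (Y N) (Ici a)) :
    ∀ i < N, ∀ t, a ≤ t → HasDerivWithinAt (Y i) (Y (i + 1) t) (Ici a) t := by
  intro i hi t ht
  refine (h i hi).hasDerivWithinAt ?_ ht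
  rcases (show i + 1 ≤ N by omega).lt_or_eq with h' | h'
  · exact (h _ h').continuousOn
  · rw [h']; exact hN

theorem isSolution_of_isPrimitiveOn {n : ℕ} (hn : 2 ≤ n) {a : ℕ → ℂ} {r : ℕ → ℝ → ℂ} {t₀ : ℝ}
    {Y : ℕ → ℝ → ℂ} (h1 : ∀ i < n - 1, IsPrimitiveOn (Y i) (Y (i + 1)) t₀)
    (h2 : IsPrimitiveOn (Y (n - 1))
      (fun t => -∑ i ∈ Finset.range n, (a i + r i t) * Y i t) t₀) :
    IsSolution n a r t₀ (Y 0) := by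
  have hd := hasDerivWithinAt_of_isPrimitiveOn_succ h1 h2.continuousOn
  have key := iteratedDerivWithin_eq_of_hasDerivWithinAt hd
  refine ⟨contDiffOn_of_hasDerivWithinAt hd h2.continuousOn, fun T hT => ?_, ?_⟩
  · refine (h2.absolutelyContinuousOnInterval hT).congr_on fun t ht => ?_
    rw [uIcc_of_le hT] at ht
    exact (key _ le_rfl t ht.1).symm
  · have hne : ∀ᵐ x : ℝ, x ≠ t₀ := by simp [ae_iff, measure_singleton]
    rw [ae_restrict_iff' measurableSet_Ici]
    filter_upwards [h2.ae_hasDerivAt, hne] with t ht hne ht0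
    have e1 : iteratedDerivWithin n (Y 0) (Ici t₀) t =
        -∑ i ∈ Finset.range n, (a i + r i t) * Y i t := by
      obtain ⟨m, rfl⟩ : ∃ m, n = m + 1 := ⟨n - 1, by omega⟩
      rw [iteratedDerivWithin_succ, derivWithin_congr (s := Ici t₀) (fun s hs => key m le_rfl s hs)
        (key m le_rfl t ht0)]
      exact (ht (lt_of_le_of_ne ht0 hne.symm)).hasDerivWithinAt.derivWithin
        (uniqueDiffOn_Ici _ t ht0)
    rw [e1, neg_add_eq_zero]
    refine Finset.sum_congr rfl fun i hi => ?_
    rw [key i (by have := Finset.mem_range.1 hi; omega) t ht0]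

theorem IsPrimitiveOn.glue {F f G g : ℝ → ℂ} {t₀ T : ℝ} (hT : t₀ ≤ T) (hF : IsPrimitiveOn F f T)
    (hg : IntervalIntegrable g volume t₀ T)
    (hG : ∀ t ∈ Icc t₀ T, G t = F T - ∫ s in t..T, g s) :
    IsPrimitiveOn (fun t => if t < T then G t else F t) (fun t => if t < T then g t else f t) t₀ := by
  set k : ℝ → ℂ := fun t => if t < T then g t else f t with hk
  have hkg : IntervalIntegrable k volume t₀ T := by
    refine hg.congr_ae ?_
    have hne : ∀ᵐ x : ℝ, x ≠ T := by simp [ae_iff, measure_singleton]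
    rw [Filter.EventuallyEq, ae_restrict_iff' measurableSet_uIoc]
    filter_upwards [hne] with s hs h
    rw [uIoc_of_le hT] at h
    simp [hk, lt_of_le_of_ne h.2 hs]
  have hkf : ∀ t, T ≤ t → k t = f t := fun t ht => by simp [hk, ht]
  have hkF : LocallyIntegrableOn k (Ici T) := (hF.congr (fun _ _ => rfl) hkf).locInt
  have hkl : ∀ t ∈ Icc t₀ T, ∫ s in t..T, k s = ∫ s in t..T, g s := fun t ht => by
    have hne : ∀ᵐ x : ℝ, x ≠ T := by simp [ae_iff, measure_singleton]
    refine intervalIntegral.integral_congr_ae ?_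
    filter_upwards [hne] with s hs h
    rw [uIoc_of_le ht.2] at h
    simp [hk, lt_of_le_of_ne h.2 hs]
  have hkr : ∀ t, T ≤ t → ∫ s in T..t, k s = ∫ s in T..t, f s := fun t ht => by
    refine intervalIntegral.integral_congr fun s hs => ?_
    rw [uIcc_of_le ht] at hs
    exact hkf s hs.1
  have hint : ∀ t, t₀ ≤ t → IntervalIntegrable k volume t₀ t := fun t ht => by
    rcases le_total t T with h | h
    · exact hkg.mono_set (by rw [uIcc_of_le hT, uIcc_of_le ht]; exact Icc_subset_Icc_right h)
    · exact hkg.trans (hkF.intervalIntegrable_of_Ici le_rfl h)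
  have hloc : LocallyIntegrableOn k (Ici t₀) := by
    rw [locallyIntegrableOn_iff isClosed_Ici.isLocallyClosed]
    intro K hK hKc
    obtain ⟨b, hb⟩ := hKc.bddAbove
    have := (intervalIntegrable_iff_integrableOn_Icc_of_le (le_max_left t₀ b)).1
      (hint (max t₀ b) (le_max_left _ _))
    exact this.mono_set fun s hs => ⟨hK hs, (hb hs).trans (le_max_right _ _)⟩
  have e0 : (if t₀ < T then G t₀ else F t₀) = F T - ∫ s in t₀..T, k s := by
    rw [hkl t₀ ⟨le_rfl, hT⟩]
    split_ifs with h
    · exact hG _ ⟨le_rfl, hT⟩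
    · have : t₀ = T := le_antisymm hT (not_lt.1 h)
      simp [this]
  refine ⟨hloc, fun t ht => ?_⟩
  simp only [e0]
  rcases lt_or_ge t T with h | h
  · rw [if_pos h, hG t ⟨ht, h.le⟩, ← hkl t ⟨ht, h.le⟩,
      ← intervalIntegral.integral_add_adjacent_intervals (hint t ht)
        (hkg.mono_set (by rw [uIcc_of_le hT, uIcc_of_le h.le]; exact Icc_subset_Icc_left ht))]
    ring
  · rw [if_neg (not_lt.2 h), hF.eq t h, ← hkr t h,
      ← intervalIntegral.integral_add_adjacent_intervals hkg
        (hkF.intervalIntegrable_of_Ici le_rfl h)]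
    ring

/-- A solution of the equation on `[T,∞)`, written as a first order system, extends to `[t₀,∞)`. -/
theorem exists_isSolution_extension {n : ℕ} (hn : 2 ≤ n) {a : ℕ → ℂ} {r : ℕ → ℝ → ℂ} {t₀ T : ℝ}
    (hT : t₀ ≤ T) (hr : ∀ i < n, LocallyIntegrableOn (r i) (Ici t₀))
    {Y : ℕ → ℝ → ℂ} (h1 : ∀ i < n - 1, IsPrimitiveOn (Y i) (Y (i + 1)) T)
    (h2 : IsPrimitiveOn (Y (n - 1))
      (fun t => -∑ i ∈ Finset.range n, (a i + r i t) * Y i t) T) :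
    ∃ y : ℝ → ℂ, IsSolution n a r t₀ y ∧
      ∀ i ≤ n - 1, ∀ t, T ≤ t → iteratedDerivWithin i y (Ici t₀) t = Y i t := by
  -- Companion form. In the Lipschitz constant `κ` below, the summand `1` serves the shift rows and
  -- the sum serves the last row.
  set A : ℝ → (Fin n → ℂ) → Fin n → ℂ := fun s U i =>
    if h : (i : ℕ) + 1 < n then U ⟨i + 1, h⟩ else -∑ k : Fin n, (a k + r k s) * U k with hA
  set κ : ℝ → ℝ := fun s => 1 + ∑ k : Fin n, ‖a k + r k s‖ with hκ
  have hri : ∀ i < n, IntervalIntegrable (fun s => a i + r i s) volume t₀ T := fun i hi =>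
    intervalIntegrable_const.add ((hr i hi).intervalIntegrable_of_Ici le_rfl hT)
  have hAint : ∀ U : ℝ → Fin n → ℂ, Continuous U → ∀ i,
      IntervalIntegrable (fun s => A s (U s) i) volume t₀ T := by
    intro U hU i
    simp only [hA]
    split_ifs with h
    · exact Continuous.intervalIntegrable (by fun_prop) _ _
    · refine IntervalIntegrable.neg ?_
      refine intervalIntegrable_fun_sum fun k _ => ?_
      exact (hri k k.2).mul_continuousOn (by fun_prop)
  obtain ⟨U, hUc, hU⟩ := exists_continuous_eq_sub_integral hT A κ
    (fun s => by positivity)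
    (intervalIntegrable_const.add (intervalIntegrable_fun_sum fun k _ => (hri k k.2).norm))
    (fun U hU => by
      rw [intervalIntegrable_iff]
      exact Integrable.of_eval fun i => (intervalIntegrable_iff.1 (hAint U hU i)))
    (fun s x y => by
      refine (pi_norm_le_iff_of_nonneg (by positivity)).2 fun i => ?_
      simp only [hA, hκ, Pi.sub_apply]
      split_ifs with h
      · refine (norm_le_pi_norm (x - y) ⟨i + 1, h⟩).trans ?_
        refine le_mul_of_one_le_left (norm_nonneg _) ?_
        have : 0 ≤ ∑ k : Fin n, ‖a k + r k s‖ := by positivity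
        linarith
      · rw [neg_sub_neg, ← Finset.sum_sub_distrib, add_mul, Finset.sum_mul]
        refine (norm_sum_le _ _).trans ?_
        have : ∀ k : Fin n, ‖(a k + r k s) * y k - (a k + r k s) * x k‖ ≤
            ‖a k + r k s‖ * ‖x - y‖ := fun k => by
          rw [← mul_sub, norm_mul, norm_sub_rev]
          gcongr
          exact norm_le_pi_norm (x - y) k
        have h3 := Finset.sum_le_sum fun k (_ : k ∈ Finset.univ) => this k
        have h4 : 0 ≤ 1 * ‖x - y‖ := by positivity
        linarith)
    (fun i => Y i T)
  have hUi : ∀ (i : Fin n), ∀ t ∈ Icc t₀ T, U t i = Y i T - ∫ s in t..T, A s (U s) i := by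
    intro i t ht
    have h3 := congrFun (hU t ht) i
    have h4 : IntervalIntegrable (fun s => A s (U s)) volume t T := by
      rw [intervalIntegrable_iff]
      refine Integrable.of_eval fun i => intervalIntegrable_iff.1 ((hAint U hUc i).mono_set ?_)
      rw [uIcc_of_le hT, uIcc_of_le ht.2]; exact Icc_subset_Icc_left ht.1
    rw [h3, Pi.sub_apply]
    congr 1
    exact ((ContinuousLinearMap.proj i : (Fin n → ℂ) →L[ℝ] ℂ).intervalIntegral_comp_comm h4).symm
  set Y' : ℕ → ℝ → ℂ := fun i t =>
    if t < T then (if h : i < n then U t ⟨i, h⟩ else 0) else Y i t with hY'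
  have hYT : ∀ i t, T ≤ t → Y' i t = Y i t := fun i t ht => by simp [hY', ht]
  have p1 : ∀ i < n - 1, IsPrimitiveOn (Y' i) (Y' (i + 1)) t₀ := by
    intro i hi
    have hi1 : i + 1 < n := by omega
    have hi0 : i < n := by omega
    have := (h1 i hi).glue hT (G := fun t => U t ⟨i, hi0⟩) (hAint U hUc ⟨i, hi0⟩)
      (fun t ht => hUi ⟨i, hi0⟩ t ht)
    refine this.congr (fun t _ => ?_) (fun t _ => ?_)
    · simp [hY', hi0]
    · simp [hY', hA, hi1]
  have p2 : IsPrimitiveOn (Y' (n - 1))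
      (fun t => -∑ i ∈ Finset.range n, (a i + r i t) * Y' i t) t₀ := by
    have hi0 : n - 1 < n := by omega
    have := h2.glue hT (G := fun t => U t ⟨n - 1, hi0⟩) (hAint U hUc ⟨n - 1, hi0⟩)
      (fun t ht => hUi ⟨n - 1, hi0⟩ t ht)
    refine this.congr (fun t _ => ?_) (fun t _ => ?_)
    · simp [hY', hi0]
    · have hnn : ¬ (n - 1 + 1 < n) := by omega
      by_cases h : t < T
      · simp only [hY', hA, h, if_true, hnn, dif_neg, not_false_eq_true, Finset.sum_range]
        simp
      · simp [hY', h]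
  refine ⟨Y' 0, isSolution_of_isPrimitiveOn hn p1 p2, fun i hi t ht => ?_⟩
  rw [← hYT i t ht]
  exact iteratedDerivWithin_eq_of_hasDerivWithinAt
    (hasDerivWithinAt_of_isPrimitiveOn_succ p1 p2.continuousOn) i hi t (hT.trans ht)

/-! ### Taylor coefficients of the characteristic polynomial and conjugation by an exponential. -/

/-- The `k`-th Taylor coefficient at `l` of `∑_{i ≤ n} c_i x^i`. -/
noncomputable def taylorCoeff (n : ℕ) (c : ℕ → ℂ) (l : ℂ) (k : ℕ) : ℂ :=
  ((hasseDeriv k) (charPoly n c)).eval l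

theorem pertDeriv_eq (n : ℕ) (r : ℕ → ℝ → ℂ) (l : ℂ) (k : ℕ) (t : ℝ) :
    pertDeriv n r l k t = (k ! : ℂ) * taylorCoeff n (fun i => r i t) l k := by
  rw [pertDeriv, taylorCoeff, ← factorial_smul_hasseDeriv]
  simp

theorem taylorCoeff_eq_sum (n : ℕ) (c : ℕ → ℂ) (l : ℂ) (k : ℕ) :
    taylorCoeff n c l k = ∑ i ∈ Finset.range (n + 1), (i.choose k : ℂ) * c i * l ^ (i - k) := by
  simp [taylorCoeff, charPoly, map_sum, hasseDeriv_monomial, eval_finsetSum]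

theorem taylorCoeff_eq_sum_choose {n : ℕ} (c : ℕ → ℂ) (l : ℂ) {k : ℕ} (hk : k ≤ n) :
    taylorCoeff n c l k =
      ∑ j ∈ Finset.range (n - k + 1), ((k + j).choose j : ℂ) * c (k + j) * l ^ j := by
  rw [taylorCoeff_eq_sum, show n + 1 = k + (n - k + 1) by omega, Finset.sum_range_add,
    Finset.sum_eq_zero, zero_add]
  · refine Finset.sum_congr rfl fun j _ => ?_
    rw [Nat.add_sub_cancel_left, Nat.choose_symm_add]
  · intro i hi
    rw [Nat.choose_eq_zero_of_lt (Finset.mem_range.1 hi)]; simp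

theorem taylorCoeff_add (n : ℕ) (c d : ℕ → ℂ) (l : ℂ) (k : ℕ) :
    taylorCoeff n (fun i => c i + d i) l k = taylorCoeff n c l k + taylorCoeff n d l k := by
  simp only [taylorCoeff_eq_sum, ← Finset.sum_add_distrib]
  exact Finset.sum_congr rfl fun i _ => by ring

theorem taylorCoeff_self (n : ℕ) (c : ℕ → ℂ) (l : ℂ) : taylorCoeff n c l n = c n := by
  rw [taylorCoeff_eq_sum_choose c l le_rfl]; simp

theorem taylorCoeff_zero (n : ℕ) (c : ℕ → ℂ) (l : ℂ) :
    taylorCoeff n c l 0 = (charPoly n c).eval l := by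
  simp [taylorCoeff]

theorem sum_taylorCoeff_mul_pow (n : ℕ) (c : ℕ → ℂ) (l x : ℂ) :
    ∑ k ∈ Finset.range (n + 1), taylorCoeff n c l k * x ^ k = (charPoly n c).eval (x + l) := by
  rw [← taylor_eval, eval_eq_sum_range' (n := n + 1)]
  · simp [taylor_coeff, taylorCoeff]
  · rw [natDegree_taylor, Nat.lt_succ_iff]
    refine natDegree_sum_le_of_forall_le _ _ fun i hi => ?_
    exact (natDegree_monomial_le _).trans (by have := Finset.mem_range.1 hi; omega)

/-- The sum is $P(c;x+l)/x$. Thus the differences $\lambda_j-\lambda$ are the characteristic roots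
of the linear part of the Riccati equation. -/
theorem sum_taylorCoeff_succ_mul_pow_eq_zero {n : ℕ} {c : ℕ → ℂ} {l x : ℂ} (hx : x ≠ 0)
    (hl : (charPoly n c).IsRoot l) (hxl : (charPoly n c).IsRoot (x + l)) :
    ∑ k ∈ Finset.range n, taylorCoeff n c l (k + 1) * x ^ k = 0 := by
  have h := sum_taylorCoeff_mul_pow n c l x
  rw [Finset.sum_range_succ', taylorCoeff_zero, hl.eq_zero, hxl.eq_zero] at h
  refine (mul_eq_zero.1 (?_ : x * _ = 0)).resolve_left hx
  rw [← h, Finset.mul_sum, zero_mul, add_zero]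
  exact Finset.sum_congr rfl fun k _ => by ring

/-- `∑_k C(i,k) l^{i-k} b_k`: if `b_k = u^{(k)}(t)/u(t)`, this is `(e^{l·} u)^{(i)}/(e^{l·} u)`. -/
noncomputable def binomialShift (l : ℂ) (b : ℕ → ℂ) (i : ℕ) : ℂ :=
  ∑ k ∈ Finset.range (i + 1), (i.choose k : ℂ) * l ^ (i - k) * b k

theorem binomialShift_zero (l : ℂ) (b : ℕ → ℂ) : binomialShift l b 0 = b 0 := by
  simp [binomialShift]

/-- Algebraic form of $(e^{lt}u)'=e^{lt}(lu+u')$, proved by Pascal's rule. -/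
theorem binomialShift_succ (l : ℂ) (b : ℕ → ℂ) (i : ℕ) :
    binomialShift l b (i + 1) = l * binomialShift l b i + binomialShift l (fun k => b (k + 1)) i := by
  simp only [binomialShift]
  rw [Finset.sum_range_succ' _ (i + 1)]
  have h1 : l * ∑ k ∈ Finset.range (i + 1), (i.choose k : ℂ) * l ^ (i - k) * b k =
      (∑ k ∈ Finset.range (i + 1), (i.choose (k + 1) : ℂ) * l ^ (i - k) * b (k + 1)) +
        l ^ (i + 1) * b 0 := by
    rw [Finset.sum_range_succ', Finset.sum_range_succ _ i, mul_add, Finset.mul_sum]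
    simp only [Nat.choose_succ_self, Nat.choose_zero_right, Nat.cast_zero, Nat.cast_one, zero_mul,
      add_zero, one_mul, Nat.sub_zero]
    congr 1
    · refine Finset.sum_congr rfl fun k hk => ?_
      have : i - k = i - (k + 1) + 1 := by have := Finset.mem_range.1 hk; omega
      rw [this, pow_succ]; ring
    · ring
  rw [h1, add_right_comm, ← Finset.sum_add_distrib]
  congr 1
  · refine Finset.sum_congr rfl fun k _ => ?_
    rw [Nat.choose_succ_succ, Nat.add_sub_add_right]; push_cast; ring
  · simp

/-- Conjugating a differential operator by $e^{lt}$ shifts its characteristic polynomial by $l$; in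
coefficients this is an interchange of sums. -/
theorem sum_mul_binomialShift (n : ℕ) (c : ℕ → ℂ) (l : ℂ) (b : ℕ → ℂ) :
    ∑ i ∈ Finset.range (n + 1), c i * binomialShift l b i =
      ∑ k ∈ Finset.range (n + 1), taylorCoeff n c l k * b k := by
  have h : ∀ i ∈ Finset.range (n + 1), binomialShift l b i =
      ∑ k ∈ Finset.range (n + 1), (i.choose k : ℂ) * l ^ (i - k) * b k := fun i hi => by
    refine Finset.sum_subset (fun k hk => ?_) fun k _ hk => ?_
    · have := Finset.mem_range.1 hi; have := Finset.mem_range.1 hk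
      exact Finset.mem_range.2 (by omega)
    · rw [Finset.mem_range, not_lt] at hk
      rw [Nat.choose_eq_zero_of_lt (by omega)]; simp
  rw [Finset.sum_congr rfl fun i hi => by rw [h i hi, Finset.mul_sum], Finset.sum_comm]
  refine Finset.sum_congr rfl fun k _ => ?_
  rw [taylorCoeff_eq_sum, Finset.sum_mul]
  exact Finset.sum_congr rfl fun i _ => by ring

/-! ### Bell polynomials and the Riccati transformation. -/

theorem bell_zero (x : ℕ → ℂ) : bell x 0 = 1 := by rw [bell]

theorem bell_succ (x : ℕ → ℂ) (i : ℕ) :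
    bell x (i + 1) = ∑ j ∈ Finset.range (i + 1), (i.choose j : ℂ) * bell x (i - j) * x j := by
  rw [bell, Finset.sum_range]

theorem bell_succ_eq_add (x : ℕ → ℂ) (i : ℕ) :
    bell x (i + 1) = (∑ j ∈ Finset.range i, (i.choose j : ℂ) * bell x (i - j) * x j) + x i := by
  rw [bell_succ, Finset.sum_range_succ]; simp [bell_zero]

theorem bell_one (x : ℕ → ℂ) : bell x 1 = x 0 := by simp [bell_succ_eq_add x 0]

theorem bell_congr {x y : ℕ → ℂ} (i : ℕ) (h : ∀ j < i, x j = y j) : bell x i = bell y i := by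
  induction i using Nat.strong_induction_on with
  | _ i ih =>
    cases i with
    | zero => simp [bell_zero]
    | succ i =>
      rw [bell_succ, bell_succ]
      refine Finset.sum_congr rfl fun j hj => ?_
      have := Finset.mem_range.1 hj
      rw [ih (i - j) (by omega) fun k hk => h k (by omega), h j this]

/-- The highest variable enters only through the linear term that is subtracted. Consequently the
remainder, despite containing $B_n$, needs the jet only up to order $n-2$. -/
theorem bell_sub_congr {x y : ℕ → ℂ} {i : ℕ} (hi : 1 ≤ i) (h : ∀ j < i - 1, x j = y j) :
    bell x i - x (i - 1) = bell y i - y (i - 1) := by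
  obtain ⟨i, rfl⟩ : ∃ k, i = k + 1 := ⟨i - 1, by omega⟩
  rw [Nat.add_sub_cancel] at h ⊢
  rw [bell_succ_eq_add, bell_succ_eq_add, add_sub_cancel_right, add_sub_cancel_right]
  refine Finset.sum_congr rfl fun j hj => ?_
  have := Finset.mem_range.1 hj
  rcases Nat.eq_zero_or_pos j with rfl | hj0
  · rw [bell_congr (i - 0) fun k hk => h k (by omega), h 0 this]
  · rw [bell_congr (i - j) fun k hk => h k (by omega), h j this]

theorem bell_zero_succ (i : ℕ) : bell (fun _ => 0) (i + 1) = 0 := by simp [bell_succ]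

theorem binomialShift_bell_zero (l : ℂ) (i : ℕ) : binomialShift l (bell (fun _ => 0)) i = l ^ i := by
  rw [binomialShift, Finset.sum_range_succ']
  simp [bell_zero_succ, bell_zero]

theorem continuous_bell (i : ℕ) : Continuous (fun x : ℕ → ℂ => bell x i) := by
  induction i using Nat.strong_induction_on with
  | _ i ih =>
    cases i with
    | zero => simpa only [bell_zero] using continuous_const
    | succ i =>
      simp only [bell_succ]
      refine continuous_finsetSum _ fun j hj => ?_
      exact (continuous_const.mul (ih (i - j) (by omega))).mul (continuous_apply j)

/-- With $z$ for `Z 0` and $u=\exp\int z$ one has $B_k=u^{(k)}/u$, whose derivative is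
$B_{k+1}-zB_k$. The proof avoids $u$: it differentiates the recursion and uses Pascal's rule. The
last entry `Z k` need only be locally integrable. -/
theorem isPrimitiveOn_bell {Z : ℕ → ℝ → ℂ} {a : ℝ} (k : ℕ)
    (h : ∀ i < k, IsPrimitiveOn (Z i) (Z (i + 1)) a) :
    IsPrimitiveOn (fun t => bell (fun i => Z i t) k)
      (fun t => bell (fun i => Z i t) (k + 1) - Z 0 t * bell (fun i => Z i t) k) a := by
  induction k using Nat.strong_induction_on with
  | _ k ih =>
    cases k with
    | zero =>
      refine (IsPrimitiveOn.const 1 a).congr (fun t _ => bell_zero _) fun t _ => ?_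
      rw [bell_zero, bell_one]; ring
    | succ k =>
      have h1 := IsPrimitiveOn.sum (Finset.range (k + 1)) fun j hj =>
        ((ih (k - j) (by omega) fun i hi => h i (by omega)).mul
          (h j (Finset.mem_range.1 hj))).const_mul (k.choose j : ℂ)
      refine h1.congr (fun t _ => ?_) fun t _ => ?_
      · rw [bell_succ]; exact Finset.sum_congr rfl fun j _ => by ring
      · set x : ℕ → ℂ := fun i => Z i t with hx
        have hx' : ∀ i, Z i t = x i := fun i => rfl
        simp only [hx']
        rw [bell_succ x k, Finset.mul_sum, eq_comm, eq_sub_iff_add_eq, ← Finset.sum_add_distrib]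
        have e : ∀ j ∈ Finset.range (k + 1), (k.choose j : ℂ) *
            ((bell x (k - j + 1) - x 0 * bell x (k - j)) * x j + bell x (k - j) * x (j + 1)) +
            x 0 * ((k.choose j : ℂ) * bell x (k - j) * x j) =
            (k.choose j : ℂ) * bell x (k + 1 - j) * x j +
              (k.choose j : ℂ) * bell x (k - j) * x (j + 1) := fun j hj => by
          rw [show k + 1 - j = k - j + 1 by have := Finset.mem_range.1 hj; omega]; ring
        rw [Finset.sum_congr rfl e, Finset.sum_add_distrib,
          Finset.sum_range_succ' (fun j => (k.choose j : ℂ) * bell x (k + 1 - j) * x j) k,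
          bell_succ x (k + 1),
          Finset.sum_range_succ' (fun j => ((k + 1).choose j : ℂ) * bell x (k + 1 - j) * x j) (k + 1)]
        have e2 : ∑ j ∈ Finset.range k, (k.choose (j + 1) : ℂ) * bell x (k + 1 - (j + 1)) * x (j + 1) =
            ∑ j ∈ Finset.range (k + 1), (k.choose (j + 1) : ℂ) * bell x (k - j) * x (j + 1) := by
          rw [Finset.sum_range_succ]
          simp
        rw [e2, add_right_comm, ← Finset.sum_add_distrib]
        congr 1
        · refine Finset.sum_congr rfl fun j _ => ?_
          rw [Nat.choose_succ_succ, Nat.add_sub_add_right]; push_cast; ring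
        · simp

theorem isPrimitiveOn_mul_binomialShift_bell {Z : ℕ → ℝ → ℂ} {y : ℝ → ℂ} {a : ℝ} {l : ℂ}
    (hy : IsPrimitiveOn y (fun t => (l + Z 0 t) * y t) a) (i : ℕ)
    (h : ∀ j < i, IsPrimitiveOn (Z j) (Z (j + 1)) a) :
    IsPrimitiveOn (fun t => y t * binomialShift l (bell fun j => Z j t) i)
      (fun t => y t * binomialShift l (bell fun j => Z j t) (i + 1)) a := by
  have h1 := IsPrimitiveOn.sum (Finset.range (i + 1)) fun k hk =>
    (isPrimitiveOn_bell k fun j hj =>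
      h j (hj.trans_le (Nat.lt_succ_iff.1 (Finset.mem_range.1 hk)))).const_mul
        ((i.choose k : ℂ) * l ^ (i - k))
  refine (hy.mul h1).congr (fun t _ => rfl) fun t _ => ?_
  rw [binomialShift_succ]
  simp only [binomialShift, mul_sub, Finset.sum_sub_distrib]
  have : ∑ k ∈ Finset.range (i + 1), (i.choose k : ℂ) * l ^ (i - k) *
      (Z 0 t * bell (fun j => Z j t) k) =
      Z 0 t * ∑ k ∈ Finset.range (i + 1), (i.choose k : ℂ) * l ^ (i - k) *
        bell (fun j => Z j t) k := by
    rw [Finset.mul_sum]; exact Finset.sum_congr rfl fun k _ => by ring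
  rw [this]; ring

theorem linTerm_eq (n : ℕ) (r : ℕ → ℝ → ℂ) (l : ℂ) (t : ℝ) (Z : ℕ → ℂ) :
    linTerm n r l t Z =
      ∑ k ∈ Finset.Icc 1 (n - 1), taylorCoeff n (fun i => r i t) l k * Z (k - 1) := by
  refine Finset.sum_congr rfl fun k _ => ?_
  rw [pertDeriv_eq, ← mul_assoc, one_div, inv_mul_cancel₀ (by exact_mod_cast k.factorial_ne_zero),
    one_mul]

theorem nonlinTerm_eq (n : ℕ) (a : ℕ → ℂ) (r : ℕ → ℝ → ℂ) (l : ℂ) (t : ℝ) (Z : ℕ → ℂ) :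
    nonlinTerm n a r l t Z =
      ∑ i ∈ Finset.Icc 2 n, (taylorCoeff n a l i + taylorCoeff n (fun k => r k t) l i) *
        (bell Z i - Z (i - 1)) := by
  refine Finset.sum_congr rfl fun i hi => ?_
  rw [← taylorCoeff_add, taylorCoeff_eq_sum_choose _ _ (Finset.mem_Icc.1 hi).2, Finset.sum_mul]

/-- The algebraic identity turning the linear equation into the Riccati type equation. -/
theorem sum_mul_binomialShift_bell {n : ℕ} (hn : 2 ≤ n) {a : ℕ → ℂ} {r : ℕ → ℝ → ℂ} {l : ℂ}
    (hl : (charPoly n a).IsRoot l) (t : ℝ) (hrn : r n t = 0) (Z : ℕ → ℂ) :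
    ∑ i ∈ Finset.range (n + 1), (a i + r i t) * binomialShift l (bell Z) i =
      (∑ k ∈ Finset.range n, taylorCoeff n a l (k + 1) * Z k) + pertDeriv n r l 0 t +
        linTerm n r l t Z + nonlinTerm n a r l t Z := by
  obtain ⟨m, rfl⟩ : ∃ m, n = m + 2 := ⟨n - 2, by omega⟩
  have hr : taylorCoeff (m + 2) (fun i => r i t) l (m + 2) = 0 := by rw [taylorCoeff_self, hrn]
  rw [sum_mul_binomialShift, linTerm_eq, nonlinTerm_eq, pertDeriv_eq]
  simp only [taylorCoeff_add]
  have e1 : ∀ f : ℕ → ℂ, ∑ i ∈ Finset.Icc 2 (m + 2), f i = ∑ i ∈ Finset.range (m + 1), f (i + 2) := by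
    intro f
    rw [Finset.range_eq_Ico, Finset.sum_Ico_add' f 0 (m + 1) 2]
    rfl
  have e2 : ∀ f : ℕ → ℂ, ∑ i ∈ Finset.Icc 1 (m + 2 - 1), f i = ∑ i ∈ Finset.range (m + 1), f (i + 1) := by
    intro f
    rw [Finset.range_eq_Ico, Finset.sum_Ico_add' f 0 (m + 1) 1]
    rfl
  have e3 : ∑ i ∈ Finset.Icc 1 (m + 2 - 1), taylorCoeff (m + 2) (fun i => r i t) l i * Z (i - 1) =
      ∑ i ∈ Finset.range (m + 2), taylorCoeff (m + 2) (fun i => r i t) l (i + 1) * Z i := by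
    rw [e2, Finset.sum_range_succ _ (m + 1), hr]; simp
  rw [e3, e1, Finset.sum_range_succ', Finset.sum_range_succ', taylorCoeff_zero _ a, hl.eq_zero,
    bell_zero, bell_one, Finset.sum_range_succ' _ (m + 1), Finset.sum_range_succ' _ (m + 1)]
  have e4 : ∀ i, i + 2 - 1 = i + 1 := fun i => rfl
  simp only [e4, mul_sub, Finset.sum_sub_distrib, add_mul, Finset.sum_add_distrib,
    Nat.factorial_zero, Nat.cast_one, show ∀ i, i + 1 + 1 = i + 2 from fun _ => rfl]
  ring

/-! ### Interpolation identities for the constants `Γ_j`. -/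

section Lagrange

variable {m : ℕ} {γ : Fin m → ℂ}

/-- Both sides are the top coefficient of the Lagrange interpolant of `P` at the nodes `γ j`.
Applied to powers, it shows that `G` produces the forcing term only in the last derivative. -/
theorem sum_eval_div_bigGamma (hγ : Function.Injective γ) {P : ℂ[X]} (hP : P.degree < m) :
    ∑ j, P.eval (γ j) / bigGamma γ j = P.coeff (m - 1) := by
  have := Lagrange.coeff_eq_sum (s := Finset.univ) (v := γ) hγ.injOn (P := P) (by simpa using hP)
  simpa [bigGamma] using this.symm

theorem sum_pow_div_bigGamma (hγ : Function.Injective γ) {i : ℕ} (hi : i < m) :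
    ∑ j, γ j ^ i / bigGamma γ j = if i = m - 1 then 1 else 0 := by
  have := sum_eval_div_bigGamma hγ (P := X ^ i) (by simpa using hi)
  simpa [coeff_X_pow, eq_comm] using this

theorem bigGamma_ne_zero (hγ : Function.Injective γ) (j : Fin m) : bigGamma γ j ≠ 0 :=
  Finset.prod_ne_zero_iff.2 fun _ hk =>
    sub_ne_zero.2 fun h => (Finset.mem_erase.1 hk).1 (hγ h).symm

/-- Evaluate at `0` the identity that the Lagrange basis polynomials sum to `1`. This is the
constant in front of $\int P(r;\lambda)$ in the asymptotic formula. -/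
theorem sum_one_div_bigGamma_mul (hm : 1 ≤ m) (hγ : Function.Injective γ) (h0 : ∀ j, γ j ≠ 0) :
    ∑ j, 1 / (bigGamma γ j * γ j) = (-1) ^ (m - 1) * ∏ k, (γ k)⁻¹ := by
  have : NeZero m := ⟨by omega⟩
  have h1 := Lagrange.sum_basis (s := Finset.univ) (v := γ) hγ.injOn Finset.univ_nonempty
  have h2 := congrArg (eval 0) h1
  rw [eval_finsetSum, eval_one] at h2
  have h3 : ∀ j, eval 0 (Lagrange.basis Finset.univ γ j) =
      (-1) ^ (m - 1) * (∏ k, γ k) * (1 / (bigGamma γ j * γ j)) := fun j => by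
    rw [Lagrange.basis, eval_prod]
    simp only [Lagrange.basisDivisor, eval_mul, eval_C, eval_sub, eval_X, zero_sub]
    rw [Finset.prod_mul_distrib, Finset.prod_inv_distrib, Finset.prod_neg,
      Finset.card_erase_of_mem (Finset.mem_univ _), Finset.card_univ, Fintype.card_fin,
      ← Finset.mul_prod_erase Finset.univ γ (Finset.mem_univ j), bigGamma]
    have := bigGamma_ne_zero hγ j
    have := h0 j
    rw [bigGamma] at *
    field_simp
  simp only [h3, ← Finset.mul_sum] at h2
  have hp : (∏ k, γ k) ≠ 0 := Finset.prod_ne_zero_iff.2 fun k _ => h0 k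
  have hs : ((-1 : ℂ) ^ (m - 1)) * (-1) ^ (m - 1) = 1 := by rw [← mul_pow]; simp
  rw [Finset.prod_inv_distrib]
  field_simp
  linear_combination (-1) ^ (m - 1) * h2 - (∏ k, γ k) * (∑ j, 1 / (bigGamma γ j * γ j)) * hs

end Lagrange

/-! ### Smallness of the nonlinear part of the Bell polynomials. -/

/-- Extension of a vector by zero to a sequence. -/
def extendZero {m : ℕ} (U : Fin m → ℂ) (k : ℕ) : ℂ := if h : k < m then U ⟨k, h⟩ else 0

theorem norm_extendZero_sub_le {m : ℕ} (U V : Fin m → ℂ) (k : ℕ) :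
    ‖extendZero U k - extendZero V k‖ ≤ ‖U - V‖ := by
  unfold extendZero
  split_ifs with h
  · exact norm_le_pi_norm (U - V) ⟨k, h⟩
  · simp

theorem extendZero_zero {m : ℕ} : extendZero (0 : Fin m → ℂ) = fun _ => 0 := by
  ext k; simp [extendZero]

theorem continuous_extendZero {m : ℕ} : Continuous (extendZero (m := m)) := by
  refine continuous_pi fun k => ?_
  unfold extendZero
  split_ifs with h <;> fun_prop

/-- $B_{i+1}-x_{i+1}$ is a sum of products of two factors vanishing at `0`, so the two derivatives
coincide. Strictness is needed because differences at two nearby points are to be estimated, not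
only values. -/
theorem hasStrictFDerivAt_bell_extendZero {m : ℕ} (i : ℕ) :
    ∃ L : (Fin m → ℂ) →L[ℂ] ℂ, HasStrictFDerivAt (fun U => extendZero U i) L 0 ∧
      HasStrictFDerivAt (fun U => bell (extendZero U) (i + 1)) L 0 := by
  have hx : ∀ j, ∃ L : (Fin m → ℂ) →L[ℂ] ℂ, HasStrictFDerivAt (fun U => extendZero U j) L 0 := by
    intro j
    by_cases h : j < m
    · refine ⟨ContinuousLinearMap.proj ⟨j, h⟩, ?_⟩
      simpa [extendZero, h] using!
        (ContinuousLinearMap.proj (R := ℂ) ⟨j, h⟩ : (Fin m → ℂ) →L[ℂ] ℂ).hasStrictFDerivAt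
    · exact ⟨0, by simpa [extendZero, h] using hasStrictFDerivAt_const (0 : ℂ) (0 : Fin m → ℂ)⟩
  induction i using Nat.strong_induction_on with
  | _ i ih =>
    obtain ⟨L, hL⟩ := hx i
    refine ⟨L, hL, ?_⟩
    have h1 : ∀ j ∈ Finset.range i, HasStrictFDerivAt
        (fun U : Fin m → ℂ => (i.choose j : ℂ) * bell (extendZero U) (i - j) * extendZero U j)
        (0 : (Fin m → ℂ) →L[ℂ] ℂ) 0 := by
      intro j hj
      have hj' := Finset.mem_range.1 hj
      obtain ⟨k, hk⟩ : ∃ k, i - j = k + 1 := ⟨i - j - 1, by omega⟩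
      obtain ⟨L1, -, h1⟩ := ih k (by omega)
      obtain ⟨L2, h2⟩ := hx j
      rw [hk]
      have h3 := (h1.const_mul (i.choose j : ℂ)).mul h2
      refine h3.congr_fderiv (ContinuousLinearMap.ext fun v => ?_)
      simp [extendZero_zero, bell_zero_succ]
    have h2 := (HasStrictFDerivAt.fun_sum h1).add hL
    simp only [Finset.sum_const_zero, zero_add] at h2
    simpa only [bell_succ_eq_add] using! h2

theorem exists_norm_bell_sub_le {m : ℕ} (n : ℕ) {η : ℝ} (hη : 0 < η) :
    ∃ δ > 0, ∀ i ∈ Finset.Icc 2 n, ∀ x y : Fin m → ℂ, ‖x‖ ≤ δ → ‖y‖ ≤ δ →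
      ‖(bell (extendZero x) i - extendZero x (i - 1)) -
        (bell (extendZero y) i - extendZero y (i - 1))‖ ≤ η * ‖x - y‖ := by
  have h1 : ∀ i ∈ Finset.Icc 2 n, ∀ᶠ p : (Fin m → ℂ) × (Fin m → ℂ) in 𝓝 (0, 0),
      ‖(bell (extendZero p.1) i - extendZero p.1 (i - 1)) -
        (bell (extendZero p.2) i - extendZero p.2 (i - 1))‖ ≤ η * ‖p.1 - p.2‖ := by
    intro i hi
    obtain ⟨k, rfl⟩ : ∃ k, i = k + 1 := ⟨i - 1, by have := (Finset.mem_Icc.1 hi).1; omega⟩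
    obtain ⟨L, h2, h3⟩ := hasStrictFDerivAt_bell_extendZero (m := m) k
    have h4 := (h3.sub h2).isLittleO
    simp only [sub_self, zero_apply, sub_zero] at h4
    exact h4.bound hη
  have h2 := (Filter.eventually_all_finset _).2 h1
  rw [Metric.eventually_nhds_iff_ball] at h2
  obtain ⟨ε, hε, h⟩ := h2
  refine ⟨ε / 2, by positivity, fun i hi x y hx hy => h (x, y) ?_ i hi⟩
  rw [Metric.mem_ball, Prod.dist_eq]
  simp only [dist_zero_right]
  exact max_lt (by linarith) (by linarith)

/-! ### The scalar Green operators. -/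

theorem IsPrimitiveOn.of_variation_of_constants {γ c : ℂ} {f V : ℝ → ℂ} {a : ℝ}
    (hf : LocallyIntegrableOn f (Ici a))
    (hV : ∀ t, a ≤ t → V t = Complex.exp (γ * t) * (c + ∫ s in a..t, Complex.exp (-γ * s) * f s)) :
    IsPrimitiveOn V (fun t => γ * V t + f t) a := by
  have h1 : IsPrimitiveOn (fun t : ℝ => Complex.exp (γ * t)) (fun t => γ * Complex.exp (γ * t)) a := by
    refine .of_hasDerivWithinAt (by fun_prop) fun t _ => ?_
    have := ((Complex.ofRealCLM.hasDerivAt (x := t)).const_mul γ).cexp.hasDerivWithinAt (s := Ici a)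
    simpa [mul_comm] using! this
  have h2 : IsPrimitiveOn (fun t : ℝ => c + ∫ s in a..t, Complex.exp (-γ * s) * f s)
      (fun t => Complex.exp (-γ * t) * f t) a :=
    ⟨hf.continuousOn_mul (by fun_prop) isClosed_Ici.isLocallyClosed, fun t _ => by simp⟩
  refine (h1.mul h2).congr hV fun t ht => ?_
  rw [hV t ht, ← mul_assoc (Complex.exp (γ * t)), ← Complex.exp_add]
  simp
  ring

theorem greenKernel_of_pos {ω : ℂ} (h : 0 < ω.re) (t s : ℝ) :
    greenKernel ω t s = if t < s then -Complex.exp (ω * (t - s)) else 0 := by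
  simp [greenKernel, Real.sign_of_pos h]

theorem greenKernel_of_neg {ω : ℂ} (h : ω.re < 0) (t s : ℝ) :
    greenKernel ω t s = if s < t then Complex.exp (ω * (t - s)) else 0 := by
  simp [greenKernel, Real.sign_of_neg h]

theorem exp_mul_sub (γ : ℂ) (t s : ℝ) :
    Complex.exp (γ * (t - s)) = Complex.exp (γ * t) * Complex.exp (-γ * s) := by
  rw [← Complex.exp_add]; ring_nf

theorem integral_greenKernel_of_pos {γ : ℂ} (hγ : 0 < γ.re) {f : ℝ → ℂ} {a t b : ℝ}
    (hf : LocallyIntegrableOn f (Ici a)) (ht : a ≤ t) (hb : t ≤ b) :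
    ∫ s in a..b, greenKernel γ t s * f s =
      Complex.exp (γ * t) * ((∫ s in a..t, Complex.exp (-γ * s) * f s) -
        ∫ s in a..b, Complex.exp (-γ * s) * f s) := by
  have hE : LocallyIntegrableOn (fun s : ℝ => Complex.exp (-γ * s) * f s) (Ici a) :=
    hf.continuousOn_mul (by fun_prop) isClosed_Ici.isLocallyClosed
  have e1 : EqOn (fun _ => (0 : ℂ)) (fun s => greenKernel γ t s * f s) (uIoc a t) := fun s hs => by
    rw [uIoc_of_le ht] at hs
    simp [greenKernel_of_pos hγ, not_lt.2 hs.2]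
  have e2 : EqOn (fun s : ℝ => -Complex.exp (γ * t) * (Complex.exp (-γ * s) * f s))
      (fun s => greenKernel γ t s * f s) (uIoc t b) := fun s hs => by
    rw [uIoc_of_le hb] at hs
    simp only [greenKernel_of_pos hγ, hs.1, if_true, exp_mul_sub]; ring
  have i2 := (hE.intervalIntegrable_of_Ici ht (ht.trans hb)).const_mul (-Complex.exp (γ * t))
  rw [← intervalIntegral.integral_add_adjacent_intervals
      ((intervalIntegrable_congr e1).1 intervalIntegrable_const) ((intervalIntegrable_congr e2).1 i2),
    ← intervalIntegral.integral_congr_ae (Eventually.of_forall e1), ← intervalIntegral.integral_congr_ae (Eventually.of_forall e2),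
    ← intervalIntegral.integral_add_adjacent_intervals (hE.intervalIntegrable_of_Ici le_rfl ht)
      (hE.intervalIntegrable_of_Ici ht (ht.trans hb)), intervalIntegral.integral_const_mul]
  simp

theorem integral_greenKernel_of_neg {γ : ℂ} (hγ : γ.re < 0) {f : ℝ → ℂ} {a t b : ℝ}
    (hf : LocallyIntegrableOn f (Ici a)) (ht : a ≤ t) (hb : t ≤ b) :
    ∫ s in a..b, greenKernel γ t s * f s =
      Complex.exp (γ * t) * ∫ s in a..t, Complex.exp (-γ * s) * f s := by
  have hE : LocallyIntegrableOn (fun s : ℝ => Complex.exp (-γ * s) * f s) (Ici a) :=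
    hf.continuousOn_mul (by fun_prop) isClosed_Ici.isLocallyClosed
  have e1 : ∀ᵐ s, s ∈ uIoc a t → Complex.exp (γ * t) * (Complex.exp (-γ * s) * f s) =
      greenKernel γ t s * f s := by
    have hne : ∀ᵐ x : ℝ, x ≠ t := by simp [ae_iff, measure_singleton]
    filter_upwards [hne] with s hs h
    rw [uIoc_of_le ht] at h
    simp only [greenKernel_of_neg hγ, lt_of_le_of_ne h.2 hs, if_true, exp_mul_sub]; ring
  have e2 : EqOn (fun _ => (0 : ℂ)) (fun s => greenKernel γ t s * f s) (uIoc t b) := fun s hs => by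
    rw [uIoc_of_le hb] at hs
    simp [greenKernel_of_neg hγ, not_lt.2 hs.1.le]
  have i1 := (hE.intervalIntegrable_of_Ici le_rfl ht).const_mul (Complex.exp (γ * t))
  have i1' : IntervalIntegrable (fun s => greenKernel γ t s * f s) volume a t :=
    i1.congr_ae (by rw [Filter.EventuallyEq, ae_restrict_iff' measurableSet_uIoc]; exact e1)
  rw [← intervalIntegral.integral_add_adjacent_intervals i1'
      ((intervalIntegrable_congr e2).1 intervalIntegrable_const),
    ← intervalIntegral.integral_congr_ae e1, ← intervalIntegral.integral_congr_ae (Eventually.of_forall e2),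
    intervalIntegral.integral_const_mul]
  simp

theorem isPrimitiveOn_greenOmega {γ : ℂ} (hγ : γ.re ≠ 0) {f : ℝ → ℂ} {a : ℝ}
    (hf : LocallyIntegrableOn f (Ici a)) (hc : GreenConverges a γ f) :
    IsPrimitiveOn (greenOmega a γ f) (fun t => γ * greenOmega a γ f t + f t) a := by
  rcases lt_or_gt_of_ne hγ with h | h
  · refine .of_variation_of_constants (c := 0) hf fun t ht => ?_
    refine Tendsto.limUnder_eq (tendsto_const_nhds.congr' ?_)
    filter_upwards [eventually_ge_atTop t] with b hb
    rw [integral_greenKernel_of_neg h hf ht hb, zero_add]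
  -- For `Re γ > 0` the kernel looks to the future, and the integration constant is fixed by the
  -- full improper integral; its convergence at the single time `a` gives it at all later times.
  · obtain ⟨v, hv⟩ := hc a le_rfl
    have h1 : Tendsto (fun b => ∫ s in a..b, Complex.exp (-γ * s) * f s) atTop
        (𝓝 (-(Complex.exp (-(γ * a)) * v))) := by
      refine (hv.const_mul (Complex.exp (-(γ * a)))).neg.congr' ?_
      filter_upwards [eventually_ge_atTop a] with b hb
      rw [integral_greenKernel_of_pos h hf le_rfl hb, ← mul_assoc, ← Complex.exp_add]
      simp
    refine .of_variation_of_constants (c := Complex.exp (-(γ * a)) * v) hf fun t ht => ?_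
    have h2 := (h1.const_sub (∫ s in a..t, Complex.exp (-γ * s) * f s)).const_mul
      (Complex.exp (γ * t))
    rw [sub_neg_eq_add, add_comm] at h2
    refine Tendsto.limUnder_eq (h2.congr' ?_)
    filter_upwards [eventually_ge_atTop t] with b hb
    rw [integral_greenKernel_of_pos h hf ht hb]

theorem measurable_greenKernel (ω : ℂ) : Measurable (fun p : ℝ × ℝ => greenKernel ω p.1 p.2) := by
  unfold greenKernel
  refine Measurable.ite (measurableSet_lt ?_ ?_) ?_ ?_ <;> fun_prop

theorem measurable_greenKernel_right (ω : ℂ) (t : ℝ) : Measurable (greenKernel ω t) :=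
  (measurable_greenKernel ω).comp measurable_prodMk_left

theorem integrableOn_greenKernel_mul {ω : ℂ} {f : ℝ → ℂ} {a t : ℝ}
    (hf : LocallyIntegrableOn f (Ici a)) (h : absGreen a ω f t ≠ ∞) :
    IntegrableOn (fun s => greenKernel ω t s * f s) (Ici a) :=
  ⟨(measurable_greenKernel_right ω t).aestronglyMeasurable.mul hf.aestronglyMeasurable, h.lt_top⟩

theorem tendsto_integral_greenKernel {ω : ℂ} {f : ℝ → ℂ} {a t : ℝ}
    (hf : LocallyIntegrableOn f (Ici a)) (h : absGreen a ω f t ≠ ∞) :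
    Tendsto (fun T : ℝ => ∫ s in a..T, greenKernel ω t s * f s) atTop
      (𝓝 (∫ s in Ici a, greenKernel ω t s * f s)) := by
  rw [integral_Ici_eq_integral_Ioi]
  exact intervalIntegral_tendsto_integral_Ioi a
    ((integrableOn_greenKernel_mul hf h).mono_set Ioi_subset_Ici_self) tendsto_id

theorem greenOmega_eq_integral {ω : ℂ} {f : ℝ → ℂ} {a t : ℝ}
    (hf : LocallyIntegrableOn f (Ici a)) (h : absGreen a ω f t ≠ ∞) :
    greenOmega a ω f t = ∫ s in Ici a, greenKernel ω t s * f s :=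
  (tendsto_integral_greenKernel hf h).limUnder_eq

theorem enorm_greenOmega_le {ω : ℂ} {f : ℝ → ℂ} {a t : ℝ}
    (hf : LocallyIntegrableOn f (Ici a)) (h : absGreen a ω f t ≠ ∞) :
    ‖greenOmega a ω f t‖ₑ ≤ absGreen a ω f t := by
  rw [greenOmega_eq_integral hf h]
  exact enorm_integral_le_lintegral_enorm _

theorem greenOmega_sub {ω : ℂ} {f g : ℝ → ℂ} {a t : ℝ}
    (hf : LocallyIntegrableOn f (Ici a)) (h : absGreen a ω f t ≠ ∞)
    (hg : LocallyIntegrableOn g (Ici a)) (h' : absGreen a ω g t ≠ ∞) :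
    greenOmega a ω f t - greenOmega a ω g t =
      ∫ s in Ici a, greenKernel ω t s * (f s - g s) := by
  rw [greenOmega_eq_integral hf h, greenOmega_eq_integral hg h', ← integral_sub
    (integrableOn_greenKernel_mul hf h) (integrableOn_greenKernel_mul hg h')]
  simp only [mul_sub]

theorem enorm_greenKernel (ω : ℂ) (t s : ℝ) :
    ‖greenKernel ω t s‖ₑ = if Real.sign ω.re * (t - s) < 0 then
      ENNReal.ofReal (Real.exp (-(|ω.re| * |t - s|))) else 0 := by
  rcases lt_trichotomy ω.re 0 with h | h | h
  · rw [greenKernel_of_neg h, Real.sign_of_neg h]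
    by_cases hst : s < t
    · rw [if_pos hst, if_pos (by linarith), ← ofReal_norm, Complex.norm_exp,
        abs_of_neg h, abs_of_pos (sub_pos.2 hst)]
      simp
    · rw [if_neg hst, if_neg (by linarith)]; simp
  · simp [greenKernel, h]
  · rw [greenKernel_of_pos h, Real.sign_of_pos h]
    by_cases hst : t < s
    · rw [if_pos hst, if_pos (by linarith), enorm_neg, ← ofReal_norm, Complex.norm_exp,
        abs_of_pos h, abs_of_neg (sub_neg.2 hst)]
      simp only [Complex.mul_re, Complex.sub_re, Complex.ofReal_re, Complex.sub_im,
        Complex.ofReal_im]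
      ring_nf
    · rw [if_neg hst, if_neg (by linarith)]; simp

/-! ### The exponential average used as weight. -/

theorem enorm_greenKernel_le (ω : ℂ) (t s : ℝ) :
    ‖greenKernel ω t s‖ₑ ≤ ENNReal.ofReal (Real.exp (-(|ω.re| * |t - s|))) := by
  rw [enorm_greenKernel]; split_ifs <;> simp

/-- The two-sided exponential average `∫_{t₀}^∞ e^{-β|t-s|} |f(s)| ds`. -/
noncomputable def expAverage (t₀ β : ℝ) (f : ℝ → ℂ) (t : ℝ) : ℝ≥0∞ :=
  ∫⁻ s in Ici t₀, ENNReal.ofReal (Real.exp (-(β * |t - s|))) * ‖f s‖ₑ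

/-- The two kernels live on the complementary half-lines `s > t` and `s < t`, each with modulus
$e^{-\beta|t-s|}$; the point `s = t` is null. -/
theorem absGreen_add_absGreen_neg {β : ℝ} (hβ : 0 < β) {f : ℝ → ℂ} {t₀ : ℝ}
    (hf : LocallyIntegrableOn f (Ici t₀)) (t : ℝ) :
    absGreen t₀ (β : ℂ) f t + absGreen t₀ (-β : ℂ) f t = expAverage t₀ β f t := by
  unfold absGreen expAverage
  have hm : ∀ ω, AEMeasurable (fun s => ‖greenKernel ω t s * f s‖ₑ) (volume.restrict (Ici t₀)) :=
    fun ω => ((measurable_greenKernel_right ω t).aestronglyMeasurable.mul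
      hf.aestronglyMeasurable).enorm
  rw [← lintegral_add_left' (hm _)]
  refine lintegral_congr_ae (ae_restrict_of_ae ?_)
  have hne : ∀ᵐ x : ℝ, x ≠ t := by simp [ae_iff, measure_singleton]
  filter_upwards [hne] with s hs
  simp only [enorm_mul, enorm_greenKernel, Complex.ofReal_re, Complex.neg_re, abs_neg,
    Real.sign_of_pos hβ, Real.sign_of_neg (neg_neg_of_pos hβ), abs_of_pos hβ]
  rcases lt_or_gt_of_ne hs with h | h
  · rw [if_neg (by linarith), if_pos (by linarith)]; simp
  · rw [if_pos (by linarith), if_neg (by linarith)]; simp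

theorem expAverage_le {t₀ β : ℝ} (hβ : 0 < β) (f : ℝ → ℂ) (t : ℝ) :
    expAverage t₀ β f t ≤ ∫⁻ s in Ici t₀, ‖f s‖ₑ := by
  refine lintegral_mono fun s => ?_
  refine mul_le_of_le_one_left zero_le ?_
  rw [ENNReal.ofReal_le_one, Real.exp_le_one_iff]
  have : 0 ≤ β * |t - s| := by positivity
  linarith

/-- Slow variation of the weight, from $|t-u|\le|t-s|+|s-u|$. -/
theorem ofReal_exp_mul_expAverage_le {t₀ β : ℝ} (hβ : 0 < β) (f : ℝ → ℂ) (t s : ℝ) :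
    ENNReal.ofReal (Real.exp (-(β * |t - s|))) * expAverage t₀ β f s ≤ expAverage t₀ β f t := by
  unfold expAverage
  rw [← lintegral_const_mul' _ _ ENNReal.ofReal_ne_top]
  refine lintegral_mono fun u => ?_
  dsimp only
  rw [← mul_assoc, ← ENNReal.ofReal_mul (Real.exp_pos _).le, ← Real.exp_add]
  gcongr
  have := abs_sub_le t s u
  nlinarith

theorem sign_sub_and_abs_sub {x β : ℝ} (hβ : 0 < β) (hx : β < |x|) :
    Real.sign (x - Real.sign x * β) = Real.sign x ∧ |x - Real.sign x * β| = |x| - β := by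
  have h0 : x ≠ 0 := fun h => by rw [h, abs_zero] at hx; linarith
  rcases lt_or_gt_of_ne h0 with h | h
  · rw [abs_of_neg h] at hx
    rw [Real.sign_of_neg h, Real.sign_of_neg (by linarith), abs_of_neg h, abs_of_neg (by linarith)]
    exact ⟨rfl, by ring⟩
  · rw [abs_of_pos h] at hx
    rw [Real.sign_of_pos h, Real.sign_of_pos (by linarith), abs_of_pos h, abs_of_pos (by linarith)]
    exact ⟨rfl, by ring⟩

/-- Moving the weight from `s` to `t` costs $e^{\beta|t-s|}$, which the decay
$e^{-|\Re\gamma||t-s|}$ of the kernel absorbs, leaving the rate $|\Re\gamma|-\beta$ on the same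
side. -/
theorem enorm_greenKernel_mul_expAverage_le {γ : ℂ} {t₀ β : ℝ} (hβ : 0 < β) (hβγ : β < |γ.re|)
    (f : ℝ → ℂ) (t s : ℝ) :
    ‖greenKernel γ t s‖ₑ * expAverage t₀ β f s ≤
      ‖greenKernel ((γ.re - Real.sign γ.re * β : ℝ) : ℂ) t s‖ₑ * expAverage t₀ β f t := by
  have hs := sign_sub_and_abs_sub hβ hβγ
  rw [enorm_greenKernel, enorm_greenKernel, Complex.ofReal_re, hs.1, hs.2]
  split_ifs
  · refine le_trans (le_of_eq ?_) (mul_le_mul_right (ofReal_exp_mul_expAverage_le hβ f t s) _)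
    rw [← mul_assoc, ← ENNReal.ofReal_mul (Real.exp_pos _).le, ← Real.exp_add]
    ring_nf
  · simp

theorem enorm_greenKernel_le_sub {γ : ℂ} {β : ℝ} (hβ : 0 < β) (hβγ : β < |γ.re|) (t s : ℝ) :
    ‖greenKernel γ t s‖ₑ ≤ ‖greenKernel ((γ.re - Real.sign γ.re * β : ℝ) : ℂ) t s‖ₑ := by
  have hs := sign_sub_and_abs_sub hβ hβγ
  rw [enorm_greenKernel, enorm_greenKernel, Complex.ofReal_re, hs.1, hs.2]
  split_ifs
  · gcongr; linarith
  · simp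

theorem absGreen_le_expAverage {γ : ℂ} {t₀ T β : ℝ} (hβγ : β < |γ.re|) (hT : t₀ ≤ T)
    (f : ℝ → ℂ) (t : ℝ) : absGreen T γ f t ≤ expAverage t₀ β f t := by
  refine (lintegral_mono_set (Ici_subset_Ici.2 hT)).trans (lintegral_mono fun s => ?_)
  rw [enorm_mul]
  gcongr
  refine (enorm_greenKernel_le γ t s).trans ?_
  gcongr

theorem lintegral_exp_neg_mul_abs_ne_top {β : ℝ} (hβ : 0 < β) :
    ∫⁻ t : ℝ, ENNReal.ofReal (Real.exp (-(β * |t|))) ≠ ∞ := by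
  have h1 : IntegrableOn (fun t => Real.exp (-(β * |t|))) (Ioi 0) :=
    (integrableOn_exp_mul_Ioi (neg_neg_of_pos hβ) 0).congr_fun
      (fun t ht => by simp [abs_of_pos (mem_Ioi.1 ht)]) measurableSet_Ioi
  have h2 : IntegrableOn (fun t => Real.exp (-(β * |t|))) (Iic 0) :=
    (integrableOn_exp_mul_Iic hβ 0).congr_fun
      (fun t ht => by simp [abs_of_nonpos (mem_Iic.1 ht)]) measurableSet_Iic
  have h3 := h2.union h1
  rw [Iic_union_Ioi, integrableOn_univ] at h3
  exact h3.lintegral_lt_top.ne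

/-- Tonelli: the average is bounded by a convolution of $|f|$ with the integrable function
$e^{-\beta|\cdot|}$. -/
theorem lintegral_expAverage_ne_top {t₀ β : ℝ} (hβ : 0 < β) {f : ℝ → ℂ}
    (hf : IntegrableOn f (Ici t₀)) : ∫⁻ t in Ici t₀, expAverage t₀ β f t ≠ ∞ := by
  unfold expAverage
  rw [lintegral_lintegral_swap]
  · have h1 : ∀ s, ∫⁻ t in Ici t₀, ENNReal.ofReal (Real.exp (-(β * |t - s|))) * ‖f s‖ₑ ≤
        (∫⁻ t : ℝ, ENNReal.ofReal (Real.exp (-(β * |t|)))) * ‖f s‖ₑ := fun s => by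
      rw [lintegral_mul_const _ (by fun_prop)]
      refine mul_le_mul' ((setLIntegral_le_lintegral _ _).trans (le_of_eq ?_)) le_rfl
      exact lintegral_sub_right_eq_self (fun t => ENNReal.ofReal (Real.exp (-(β * |t|)))) s
    refine ne_top_of_le_ne_top ?_ (lintegral_mono h1)
    rw [lintegral_const_mul' _ _ (lintegral_exp_neg_mul_abs_ne_top hβ)]
    exact ENNReal.mul_ne_top (lintegral_exp_neg_mul_abs_ne_top hβ) hf.2.ne
  · exact AEMeasurable.mul (by fun_prop) hf.1.enorm.comp_snd

theorem tendsto_expAverage {t₀ β : ℝ} (hβ : 0 < β) {f : ℝ → ℂ}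
    (hf : IntegrableOn f (Ici t₀)) : Tendsto (expAverage t₀ β f) atTop (𝓝 0) := by
  have := tendsto_lintegral_filter_of_dominated_convergence' (μ := volume.restrict (Ici t₀))
    (l := atTop) (F := fun t s => ENNReal.ofReal (Real.exp (-(β * |t - s|))) * ‖f s‖ₑ)
    (f := fun _ => 0) (fun s => ‖f s‖ₑ)
    (Eventually.of_forall fun t => AEMeasurable.mul (by fun_prop) hf.1.enorm)
    (Eventually.of_forall fun t => Eventually.of_forall fun s => by
      refine mul_le_of_le_one_left zero_le ?_
      rw [ENNReal.ofReal_le_one, Real.exp_le_one_iff]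
      have : 0 ≤ β * |t - s| := by positivity
      linarith) hf.2.ne
    (Eventually.of_forall fun s => by
      have h1 : Tendsto (fun t : ℝ => -(β * |t - s|)) atTop atBot :=
        tendsto_neg_atTop_atBot.comp (Tendsto.const_mul_atTop hβ
          (tendsto_abs_atTop_atTop.comp (tendsto_atTop_add_const_right _ (-s) tendsto_id)))
      have h2 := ENNReal.tendsto_ofReal (Real.tendsto_exp_atBot.comp h1)
      rw [ENNReal.ofReal_zero] at h2
      simpa using ENNReal.Tendsto.mul_const h2 (Or.inr enorm_ne_top))
  rwa [lintegral_zero] at this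

/-! ### The fixed point theorem for the Green system. -/

theorem enorm_pi_le {ι : Type*} [Fintype ι] {x : ι → ℂ} {B : ℝ≥0∞} (h : ∀ i, ‖x i‖ₑ ≤ B) :
    ‖x‖ₑ ≤ B := by
  rw [← edist_zero_right, edist_pi_le_iff]
  exact fun i => by simpa using h i

theorem norm_le_of_enorm_le_ofReal {E : Type*} [SeminormedAddCommGroup E] {x : E} {δ : ℝ}
    (hδ : 0 ≤ δ) (h : ‖x‖ₑ ≤ ENNReal.ofReal δ) : ‖x‖ ≤ δ := by
  rwa [← ofReal_norm, ENNReal.ofReal_le_ofReal_iff hδ] at h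

/-- A fixed point of a system of Green operators with a locally Lipschitz nonlinearity. The
solution is controlled pointwise by the weight `ρ`. -/
theorem exists_green_fixedPoint {m : ℕ} {T : ℝ} {γ : Fin m → ℂ} (hγ : ∀ j, (γ j).re ≠ 0)
    {d : Fin m → Fin m → ℂ} {C : Fin m → ℝ≥0∞} (hC0 : ∀ j, C j ≠ 0)
    (hd : ∀ i j, ‖d i j‖ₑ ≤ C j) (h : ℝ → (Fin m → ℂ) → ℂ) (κ ρ : ℝ → ℝ≥0∞) {δ : ℝ} (hδ : 0 ≤ δ)
    {M q : NNReal} (hq : q < 1)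
    (hloc : ∀ U : ℝ → Fin m → ℂ, Continuous U → LocallyIntegrableOn (fun s => h s (U s)) (Ici T))
    (hlip : ∀ s, T ≤ s → ∀ x y, ‖x‖ ≤ δ → ‖y‖ ≤ δ → ‖h s x - h s y‖ₑ ≤ κ s * ‖x - y‖ₑ)
    (hρ : ∀ t, T ≤ t → ρ t ≠ ∞) (hρδ : ∀ t, T ≤ t → M * ρ t ≤ ENNReal.ofReal δ)
    (h0 : ∀ t, T ≤ t → ∀ j, absGreen T (γ j) (fun s => h s 0) t ≤ ρ t)
    (hc1 : ∀ t, T ≤ t → ∑ j, C j * ∫⁻ s in Ici T, ‖greenKernel (γ j) t s‖ₑ * κ s ≤ q)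
    (hc2 : ∀ t, T ≤ t → ∑ j, C j * ∫⁻ s in Ici T, ‖greenKernel (γ j) t s‖ₑ * (κ s * ρ s) ≤ q * ρ t)
    (hM : ∑ j, C j + q * M ≤ M) :
    ∃ U : ℝ → Fin m → ℂ, Continuous U ∧ (∀ t, T ≤ t → ‖U t‖ₑ ≤ M * ρ t) ∧
      (∀ j, GreenConverges T (γ j) (fun s => h s (U s))) ∧
      ∀ t, T ≤ t → ∀ i, U t i = -∑ j, d i j * greenOmega T (γ j) (fun s => h s (U s)) t := by
  -- The weight only cuts out a closed subset; distances are measured in the plain sup norm.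
  -- Invariance of `S` uses `hc2` and `hM`, contraction uses `hc1`.
  set S : Set (BoundedContinuousFunction ℝ (Fin m → ℂ)) := {U | ∀ t, ‖U t‖ₑ ≤ M * ρ (max t T)}
    with hS
  have hSc : IsClosed S := by
    rw [hS, Set.ofPred_forall]
    exact isClosed_iInter fun t => isClosed_le
      (continuous_enorm.comp (continuous_eval_const t)) continuous_const
  have hSm : ∀ U ∈ S, ∀ s, T ≤ s → ‖U s‖ₑ ≤ M * ρ s := fun U hU s hs => by
    simpa [max_eq_left hs] using hU s
  have hSδ : ∀ U ∈ S, ∀ s, T ≤ s → ‖U s‖ ≤ δ := fun U hU s hs =>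
    norm_le_of_enorm_le_ofReal hδ ((hSm U hU s hs).trans (hρδ s hs))
  -- Finiteness of each single integral follows from the bound on the weighted sum because no weight
  -- `C j` vanishes.
  have hX : ∀ t, T ≤ t → ∀ j, ∫⁻ s in Ici T, ‖greenKernel (γ j) t s‖ₑ * (κ s * ρ s) ≠ ∞ := by
    intro t ht j hj
    have h1 := (Finset.single_le_sum (f := fun j => C j *
      ∫⁻ s in Ici T, ‖greenKernel (γ j) t s‖ₑ * (κ s * ρ s)) (fun _ _ => zero_le)
      (Finset.mem_univ j)).trans (hc2 t ht)
    simp only [hj, ENNReal.mul_top (hC0 j)] at h1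
    exact ENNReal.mul_ne_top ENNReal.coe_ne_top (hρ t ht) (top_le_iff.1 h1)
  have hG : ∀ U ∈ S, ∀ t, T ≤ t → ∀ j, absGreen T (γ j) (fun s => h s (U s)) t ≤
      ρ t + M * ∫⁻ s in Ici T, ‖greenKernel (γ j) t s‖ₑ * (κ s * ρ s) := by
    intro U hU t ht j
    have h1 : absGreen T (γ j) (fun s => h s (U s)) t ≤
        ∫⁻ s in Ici T, (‖greenKernel (γ j) t s * h s 0‖ₑ +
          M * (‖greenKernel (γ j) t s‖ₑ * (κ s * ρ s))) := by
      refine setLIntegral_mono' measurableSet_Ici fun s hs => ?_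
      have e1 : h s (U s) = h s 0 + (h s (U s) - h s 0) := by ring
      have e2 := hlip s hs (U s) 0 (hSδ U hU s hs) (by simpa using hδ)
      rw [sub_zero] at e2
      have e3 : κ s * ‖U s‖ₑ ≤ κ s * (M * ρ s) := by gcongr; exact hSm U hU s hs
      dsimp only
      rw [e1, mul_add]
      refine (enorm_add_le _ _).trans ?_
      gcongr
      rw [enorm_mul]
      calc _ ≤ ‖greenKernel (γ j) t s‖ₑ * (κ s * (M * ρ s)) := by gcongr; exact e2.trans e3
        _ = _ := by ring
    refine h1.trans ?_
    rw [lintegral_add_left', lintegral_const_mul' _ _ ENNReal.coe_ne_top]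
    · gcongr; exact h0 t ht j
    · exact ((measurable_greenKernel_right _ t).aestronglyMeasurable.mul
        (hloc (fun _ => 0) continuous_const).aestronglyMeasurable).enorm
  have hGf : ∀ U ∈ S, ∀ t, T ≤ t → ∀ j, absGreen T (γ j) (fun s => h s (U s)) t ≠ ∞ :=
    fun U hU t ht j => ne_top_of_le_ne_top (ENNReal.add_ne_top.2 ⟨hρ t ht,
      ENNReal.mul_ne_top ENNReal.coe_ne_top (hX t ht j)⟩) (hG U hU t ht j)
  have hconv : ∀ U ∈ S, ∀ j, GreenConverges T (γ j) (fun s => h s (U s)) := fun U hU j t ht =>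
    ⟨_, tendsto_integral_greenKernel (hloc U U.continuous) (hGf U hU t ht j)⟩
  set Ψ : BoundedContinuousFunction ℝ (Fin m → ℂ) → ℝ → Fin m → ℂ := fun U t i =>
    -∑ j, d i j * greenOmega T (γ j) (fun s => h s (U s)) (max t T) with hΨ
  have hΨc : ∀ U ∈ S, Continuous (Ψ U) := by
    intro U hU
    refine continuous_pi fun i => (continuous_finsetSum _ fun j _ => continuous_const.mul ?_).neg
    exact (isPrimitiveOn_greenOmega (hγ j) (hloc U U.continuous) (hconv U hU j)).continuousOn
      |>.comp_continuous (by fun_prop) fun t => mem_Ici.2 (le_max_right _ _)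
  have hΨb : ∀ U ∈ S, ∀ t, ‖Ψ U t‖ₑ ≤ M * ρ (max t T) := by
    intro U hU t
    have ht : T ≤ max t T := le_max_right _ _
    refine enorm_pi_le fun i => ?_
    simp only [hΨ, enorm_neg]
    refine (enorm_sum_le _ _).trans ?_
    calc _ ≤ ∑ j, C j * (ρ (max t T) + M * ∫⁻ s in Ici T,
            ‖greenKernel (γ j) (max t T) s‖ₑ * (κ s * ρ s)) := by
          refine Finset.sum_le_sum fun j _ => ?_
          rw [enorm_mul]
          exact mul_le_mul' (hd i j) ((enorm_greenOmega_le (hloc U U.continuous)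
            (hGf U hU _ ht j)).trans (hG U hU _ ht j))
      _ = (∑ j, C j) * ρ (max t T) + M * ∑ j, C j * ∫⁻ s in Ici T,
            ‖greenKernel (γ j) (max t T) s‖ₑ * (κ s * ρ s) := by
          rw [Finset.sum_mul, Finset.mul_sum, ← Finset.sum_add_distrib]
          exact Finset.sum_congr rfl fun j _ => by ring
      _ ≤ (∑ j, C j) * ρ (max t T) + M * (q * ρ (max t T)) := by gcongr; exact hc2 _ ht
      _ = (∑ j, C j + q * M) * ρ (max t T) := by ring
      _ ≤ _ := by gcongr
  set Φ : S → S := fun U => ⟨BoundedContinuousFunction.ofNormedAddCommGroup (Ψ U) (hΨc U U.2) δ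
    (fun t => norm_le_of_enorm_le_ofReal hδ ((hΨb U U.2 t).trans (hρδ _ (le_max_right _ _)))),
    fun t => hΨb U U.2 t⟩ with hΦ
  have hcon : ContractingWith q Φ := by
    refine ⟨by exact_mod_cast hq, LipschitzWith.of_dist_le_mul fun U V => ?_⟩
    refine (BoundedContinuousFunction.dist_le (by positivity)).2 fun t => ?_
    have ht : T ≤ max t T := le_max_right _ _
    have hd0 : ∀ s, ‖U.1 s - V.1 s‖ₑ ≤ ENNReal.ofReal (dist U V) := fun s => by
      rw [← ofReal_norm, ← dist_eq_norm]
      exact ENNReal.ofReal_le_ofReal (BoundedContinuousFunction.dist_coe_le_dist s)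
    have key : ‖Ψ U t - Ψ V t‖ₑ ≤ ENNReal.ofReal (q * dist U V) := by
      refine enorm_pi_le fun i => ?_
      simp only [hΨ, Pi.sub_apply, neg_sub_neg, ← Finset.sum_sub_distrib, ← mul_sub]
      refine (enorm_sum_le _ _).trans ?_
      calc _ ≤ ∑ j, C j * ((∫⁻ s in Ici T, ‖greenKernel (γ j) (max t T) s‖ₑ * κ s) *
              ENNReal.ofReal (dist U V)) := by
            refine Finset.sum_le_sum fun j _ => ?_
            rw [enorm_mul, ← neg_sub, enorm_neg, greenOmega_sub (hloc U U.1.continuous) (hGf U U.2 _ ht j)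
              (hloc V V.1.continuous) (hGf V V.2 _ ht j)]
            refine mul_le_mul' (hd i j) ((enorm_integral_le_lintegral_enorm _).trans ?_)
            rw [← lintegral_mul_const' _ _ ENNReal.ofReal_ne_top]
            refine setLIntegral_mono' measurableSet_Ici fun s hs => ?_
            rw [enorm_mul, mul_assoc]
            gcongr
            exact (hlip s hs _ _ (hSδ U U.2 s hs) (hSδ V V.2 s hs)).trans
              (mul_le_mul' le_rfl (hd0 s))
        _ = (∑ j, C j * ∫⁻ s in Ici T, ‖greenKernel (γ j) (max t T) s‖ₑ * κ s) *
              ENNReal.ofReal (dist U V) := by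
            rw [Finset.sum_mul]; exact Finset.sum_congr rfl fun j _ => by ring
        _ ≤ q * ENNReal.ofReal (dist U V) := by gcongr; exact hc1 _ ht
        _ = _ := by rw [ENNReal.ofReal_mul q.coe_nonneg, ENNReal.ofReal_coe_nnreal]
    rw [dist_eq_norm]
    exact norm_le_of_enorm_le_ofReal (by positivity) key
  have := hSc.completeSpace_coe
  have hzero : (0 : BoundedContinuousFunction ℝ (Fin m → ℂ)) ∈ S := fun t => by simp
  obtain ⟨U, hU, -⟩ := hcon.exists_fixedPoint ⟨0, hzero⟩ (edist_ne_top _ _)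
  refine ⟨U.1, U.1.continuous, hSm U U.2, hconv U U.2, fun t ht i => ?_⟩
  have h1 : U.1 t = Ψ U t := by
    conv_lhs => rw [← hU.eq]
    rfl
  rw [h1]
  simp only [hΨ, max_eq_left ht]

/-! ### Derivatives of the Green operator. -/

/-- The combinations `∑_j γ_j^i Γ_j⁻¹ V_j`, the derivatives of `∑_j Γ_j⁻¹ V_j`. -/
noncomputable def greenJet {m : ℕ} (γ : Fin m → ℂ) (V : Fin m → ℝ → ℂ) (i : ℕ) (t : ℝ) : ℂ :=
  ∑ j, γ j ^ i / bigGamma γ j * V j t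

theorem isPrimitiveOn_greenJet_aux {m : ℕ} {γ : Fin m → ℂ} {V : Fin m → ℝ → ℂ}
    {f : ℝ → ℂ} {a : ℝ} (hV : ∀ j, IsPrimitiveOn (V j) (fun t => γ j * V j t + f t) a) (i : ℕ) :
    IsPrimitiveOn (greenJet γ V i)
      (fun t => greenJet γ V (i + 1) t + (∑ j, γ j ^ i / bigGamma γ j) * f t) a := by
  refine (IsPrimitiveOn.sum Finset.univ fun j _ =>
    (hV j).const_mul (γ j ^ i / bigGamma γ j)).congr (fun t _ => rfl) fun t _ => ?_
  rw [greenJet, Finset.sum_mul, ← Finset.sum_add_distrib]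
  exact Finset.sum_congr rfl fun j _ => by ring

theorem isPrimitiveOn_greenJet {m : ℕ} {γ : Fin m → ℂ} (hγ : Function.Injective γ)
    {V : Fin m → ℝ → ℂ} {f : ℝ → ℂ} {a : ℝ}
    (hV : ∀ j, IsPrimitiveOn (V j) (fun t => γ j * V j t + f t) a) {i : ℕ} (hi : i < m - 1) :
    IsPrimitiveOn (greenJet γ V i) (greenJet γ V (i + 1)) a := by
  refine (isPrimitiveOn_greenJet_aux hV i).congr (fun t _ => rfl) fun t _ => ?_
  rw [sum_pow_div_bigGamma hγ (by omega), if_neg (by omega)]; ring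

theorem isPrimitiveOn_greenJet_last {m : ℕ} {γ : Fin m → ℂ} (hγ : Function.Injective γ)
    {V : Fin m → ℝ → ℂ} {f : ℝ → ℂ} {a : ℝ} (hm : 1 ≤ m)
    (hV : ∀ j, IsPrimitiveOn (V j) (fun t => γ j * V j t + f t) a) :
    IsPrimitiveOn (greenJet γ V (m - 1)) (fun t => greenJet γ V m t + f t) a := by
  refine (isPrimitiveOn_greenJet_aux hV (m - 1)).congr (fun t _ => rfl) fun t _ => ?_
  rw [sum_pow_div_bigGamma hγ (by omega), if_pos rfl, Nat.sub_add_cancel hm]; ring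

theorem greenOp_eq_greenJet {m : ℕ} (t₀ : ℝ) (γ : Fin m → ℂ) (f : ℝ → ℂ) :
    greenOp t₀ γ f = greenJet γ (fun j => greenOmega t₀ (γ j) f) 0 := by
  ext t; simp [greenOp, greenJet]

theorem iteratedDerivWithin_greenOp {m : ℕ} {γ : Fin m → ℂ} (hγ : Function.Injective γ) {f : ℝ → ℂ}
    {t₀ : ℝ} (hm : 1 ≤ m)
    (hV : ∀ j, IsPrimitiveOn (greenOmega t₀ (γ j) f)
      (fun t => γ j * greenOmega t₀ (γ j) f t + f t) t₀) {i : ℕ} (hi : i < m) {t : ℝ} (ht : t₀ ≤ t) :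
    iteratedDerivWithin i (greenOp t₀ γ f) (Ici t₀) t =
      greenJet γ (fun j => greenOmega t₀ (γ j) f) i t := by
  rw [greenOp_eq_greenJet]
  have h := hasDerivWithinAt_of_isPrimitiveOn_succ (N := m - 1)
    (Y := greenJet γ (fun j => greenOmega t₀ (γ j) f))
    (fun i hi => isPrimitiveOn_greenJet hγ hV hi)
    (isPrimitiveOn_greenJet_last hγ hm hV).continuousOn
  exact iteratedDerivWithin_eq_of_hasDerivWithinAt h i (by omega) t ht

/-! ### Estimates of the remainder and the correction to the first approximation. -/

theorem locallyIntegrableOn_fun_sum {ι : Type*} (s : Finset ι) {f : ι → ℝ → ℂ} {A : Set ℝ}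
    (h : ∀ i ∈ s, LocallyIntegrableOn (f i) A) :
    LocallyIntegrableOn (fun t => ∑ i ∈ s, f i t) A := by
  classical
  induction s using Finset.induction_on with
  | empty => simpa using locallyIntegrableOn_zero
  | insert i s hi ih =>
    simp only [Finset.sum_insert hi]
    exact (h i (by simp)).add (ih fun j hj => h j (by simp [hj]))

theorem locallyIntegrableOn_taylorCoeff {n : ℕ} {r : ℕ → ℝ → ℂ} {t₀ : ℝ}
    (hr : ∀ i < n, LocallyIntegrableOn (r i) (Ici t₀)) (hrn : ∀ t, r n t = 0) (l : ℂ) (k : ℕ) :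
    LocallyIntegrableOn (fun t => taylorCoeff n (fun i => r i t) l k) (Ici t₀) := by
  simp only [taylorCoeff_eq_sum]
  refine locallyIntegrableOn_fun_sum _ fun i hi => ?_
  have h1 : LocallyIntegrableOn (r i) (Ici t₀) := by
    rcases (Nat.lt_succ_iff.1 (Finset.mem_range.1 hi)).lt_or_eq with h | rfl
    · exact hr i h
    · rw [show r i = fun _ => 0 from funext hrn]; exact locallyIntegrableOn_zero
  have h2 := h1.smul ((i.choose k : ℂ) * l ^ (i - k))
  refine h2.congr (Eventually.of_forall fun t => ?_)
  simp only [Pi.smul_apply, smul_eq_mul]; ring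

/-- `ℒ + ℱ` as a function of the time and of the jet. -/
noncomputable def remJet (n : ℕ) (a : ℕ → ℂ) (r : ℕ → ℝ → ℂ) (l : ℂ) (t : ℝ) (Z : ℕ → ℂ) : ℂ :=
  linTerm n r l t Z + nonlinTerm n a r l t Z

theorem remJet_congr {n : ℕ} {a : ℕ → ℂ} {r : ℕ → ℝ → ℂ} {l : ℂ} {t : ℝ} {X Y : ℕ → ℂ}
    (h : ∀ k < n - 1, X k = Y k) : remJet n a r l t X = remJet n a r l t Y := by
  unfold remJet
  rw [linTerm_eq, linTerm_eq, nonlinTerm_eq, nonlinTerm_eq]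
  congr 1
  · refine Finset.sum_congr rfl fun k hk => ?_
    have := Finset.mem_Icc.1 hk
    rw [h (k - 1) (by omega)]
  · refine Finset.sum_congr rfl fun i hi => ?_
    have := Finset.mem_Icc.1 hi
    rw [bell_sub_congr (by omega) fun j hj => h j (by omega)]

theorem locallyIntegrableOn_remJet {n : ℕ} {a : ℕ → ℂ} {r : ℕ → ℝ → ℂ} {l : ℂ} {T : ℝ}
    (hr : ∀ i < n, LocallyIntegrableOn (r i) (Ici T)) (hrn : ∀ t, r n t = 0)
    {X : ℝ → ℕ → ℂ} (hX : ContinuousOn X (Ici T)) :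
    LocallyIntegrableOn (fun t => remJet n a r l t (X t)) (Ici T) := by
  have hXk : ∀ k, ContinuousOn (fun t => X t k) (Ici T) := fun k =>
    (continuous_apply k).comp_continuousOn hX
  simp only [remJet, linTerm_eq, nonlinTerm_eq]
  refine LocallyIntegrableOn.add (locallyIntegrableOn_fun_sum _ fun k _ => ?_)
    (locallyIntegrableOn_fun_sum _ fun i _ => ?_)
  · exact (locallyIntegrableOn_taylorCoeff hr hrn l k).mul_continuousOn (hXk _)
      isClosed_Ici.isLocallyClosed
  · refine LocallyIntegrableOn.mul_continuousOn ?_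
      (((continuous_bell i).comp_continuousOn hX).sub (hXk _)) isClosed_Ici.isLocallyClosed
    exact (continuousOn_const.locallyIntegrableOn measurableSet_Ici).add
      (locallyIntegrableOn_taylorCoeff hr hrn l i)

/-- The linear part contributes the perturbation coefficients with factor `1`, matching (3);
everything nonlinear carries the small factor `η`. The coefficient of index `n` drops out because `r
n s = 0`. -/
theorem enorm_remJet_sub_le {n : ℕ} (hn : 2 ≤ n) {a : ℕ → ℂ} {r : ℕ → ℝ → ℂ} {l : ℂ} {s : ℝ}
    (hrn : r n s = 0) {η : NNReal} {x y : Fin (n - 1) → ℂ}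
    (hxy : ∀ i ∈ Finset.Icc 2 n, ‖(bell (extendZero x) i - extendZero x (i - 1)) -
        (bell (extendZero y) i - extendZero y (i - 1))‖ ≤ η * ‖x - y‖) :
    ‖remJet n a r l s (extendZero x) - remJet n a r l s (extendZero y)‖ₑ ≤
      ((1 + η) * (∑ k ∈ Finset.Icc 1 (n - 1), ‖taylorCoeff n (fun i => r i s) l k‖ₑ) +
        η * ∑ i ∈ Finset.Icc 2 n, ‖taylorCoeff n a l i‖ₑ) * ‖x - y‖ₑ := by
  unfold remJet
  rw [linTerm_eq, linTerm_eq, nonlinTerm_eq, nonlinTerm_eq, add_sub_add_comm,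
    ← Finset.sum_sub_distrib, ← Finset.sum_sub_distrib]
  simp only [← mul_sub]
  have h1 : ∀ k, ‖extendZero x k - extendZero y k‖ₑ ≤ ‖x - y‖ₑ := fun k => by
    rw [← ofReal_norm, ← ofReal_norm]
    exact ENNReal.ofReal_le_ofReal (norm_extendZero_sub_le x y k)
  have h2 : ∀ i ∈ Finset.Icc 2 n, ‖(bell (extendZero x) i - extendZero x (i - 1)) -
        (bell (extendZero y) i - extendZero y (i - 1))‖ₑ ≤ η * ‖x - y‖ₑ := fun i hi => by
    rw [← ofReal_norm, ← ofReal_norm, ← ENNReal.ofReal_coe_nnreal,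
      ← ENNReal.ofReal_mul η.coe_nonneg]
    exact ENNReal.ofReal_le_ofReal (hxy i hi)
  have h3 : ∑ i ∈ Finset.Icc 2 n, ‖taylorCoeff n (fun i => r i s) l i‖ₑ ≤
      ∑ k ∈ Finset.Icc 1 (n - 1), ‖taylorCoeff n (fun i => r i s) l k‖ₑ := by
    have e : Finset.Icc 2 n = insert n (Finset.Icc 2 (n - 1)) := by
      ext k; simp only [Finset.mem_Icc, Finset.mem_insert]; omega
    rw [e, Finset.sum_insert (by simp only [Finset.mem_Icc]; omega), taylorCoeff_self, hrn,
      enorm_zero, zero_add]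
    exact Finset.sum_le_sum_of_subset (Finset.Icc_subset_Icc (by norm_num) le_rfl)
  calc _ ≤ ∑ k ∈ Finset.Icc 1 (n - 1), ‖taylorCoeff n (fun i => r i s) l k‖ₑ * ‖x - y‖ₑ +
        ∑ i ∈ Finset.Icc 2 n, (‖taylorCoeff n a l i‖ₑ +
          ‖taylorCoeff n (fun i => r i s) l i‖ₑ) * (η * ‖x - y‖ₑ) := by
        refine (enorm_add_le _ _).trans (add_le_add ((enorm_sum_le _ _).trans ?_)
          ((enorm_sum_le _ _).trans ?_))
        · refine Finset.sum_le_sum fun k _ => ?_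
          rw [enorm_mul]; exact mul_le_mul' le_rfl (h1 _)
        · refine Finset.sum_le_sum fun i hi => ?_
          rw [enorm_mul]; exact mul_le_mul' (enorm_add_le _ _) (h2 i hi)
    _ = ((∑ k ∈ Finset.Icc 1 (n - 1), ‖taylorCoeff n (fun i => r i s) l k‖ₑ) +
          η * (∑ i ∈ Finset.Icc 2 n, ‖taylorCoeff n (fun i => r i s) l i‖ₑ) +
          η * ∑ i ∈ Finset.Icc 2 n, ‖taylorCoeff n a l i‖ₑ) * ‖x - y‖ₑ := by
        rw [← Finset.sum_mul, ← Finset.sum_mul, Finset.sum_add_distrib]; ring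
    _ ≤ ((∑ k ∈ Finset.Icc 1 (n - 1), ‖taylorCoeff n (fun i => r i s) l k‖ₑ) +
          η * (∑ k ∈ Finset.Icc 1 (n - 1), ‖taylorCoeff n (fun i => r i s) l k‖ₑ) +
          η * ∑ i ∈ Finset.Icc 2 n, ‖taylorCoeff n a l i‖ₑ) * ‖x - y‖ₑ := by gcongr
    _ = _ := by ring

theorem lintegral_enorm_greenKernel_le (ω : ℂ) (t : ℝ) (A : Set ℝ) :
    ∫⁻ s in A, ‖greenKernel ω t s‖ₑ ≤
      ∫⁻ s : ℝ, ENNReal.ofReal (Real.exp (-(|ω.re| * |s|))) := by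
  refine (lintegral_mono fun s => enorm_greenKernel_le ω t s).trans
    ((setLIntegral_le_lintegral _ _).trans (le_of_eq ?_))
  exact lintegral_sub_left_eq_self (fun s => ENNReal.ofReal (Real.exp (-(|ω.re| * |s|)))) t

theorem bigGamma_weight {m : ℕ} (γ : Fin m → ℂ) (j : Fin m) (hγ : bigGamma γ j ≠ 0) (hm : 1 ≤ m) :
    (0 < alphaTilde γ j / ‖bigGamma γ j‖) ∧
      ∀ i < m, ‖γ j ^ i / bigGamma γ j‖ ≤ alphaTilde γ j / ‖bigGamma γ j‖ := by
  have h1 : ∀ i < m, ‖γ j‖ ^ i ≤ alphaTilde γ j := fun i hi =>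
    Finset.single_le_sum (f := fun i => ‖γ j‖ ^ i) (fun _ _ => by positivity)
      (Finset.mem_range.2 hi)
  have h2 := h1 0 hm
  rw [pow_zero] at h2
  refine ⟨div_pos (by linarith) (norm_pos_iff.2 hγ), fun i hi => ?_⟩
  rw [norm_div, norm_pow]
  exact div_le_div_of_nonneg_right (h1 i hi) (norm_nonneg _)

/-- The smallness condition in the form used for the contraction. -/
theorem exists_contraction_bound {n : ℕ} {r : ℕ → ℝ → ℂ} {l : ℂ} {t₀ : ℝ}
    (hr : ∀ i < n, LocallyIntegrableOn (r i) (Ici t₀)) (hrn : ∀ t, r n t = 0)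
    {γ : Fin (n - 1) → ℂ} {ω : Fin (n - 1) → ℂ} (hω : ∀ j, (ω j).re ≠ 0)
    (hcl : ∑ j, ∑ k ∈ Finset.Icc 1 (n - 1),
      ENNReal.ofReal (alphaTilde γ j / (‖bigGamma γ j‖ * (k ! : ℝ))) *
        (⨆ t ∈ Ici t₀, absGreen t₀ (ω j) (pertDeriv n r l k) t) < 1 / 2)
    {A : ℝ≥0∞} (hA : A ≠ ∞) :
    ∃ η : NNReal, 0 < η ∧ ∀ t, t₀ ≤ t →
      ∑ j, ENNReal.ofReal (alphaTilde γ j / ‖bigGamma γ j‖) *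
        ∫⁻ s in Ici t₀, ‖greenKernel (ω j) t s‖ₑ *
          ((1 + η) * (∑ k ∈ Finset.Icc 1 (n - 1), ‖taylorCoeff n (fun i => r i s) l k‖ₑ) + η * A)
        ≤ ((3 / 4 : NNReal) : ℝ≥0∞) := by
  set c : Fin (n - 1) → ℝ≥0∞ := fun j => ENNReal.ofReal (alphaTilde γ j / ‖bigGamma γ j‖) with hc
  set E : Fin (n - 1) → ℝ≥0∞ := fun j =>
    ∫⁻ s : ℝ, ENNReal.ofReal (Real.exp (-(|(ω j).re| * |s|))) with hE
  set B : ℝ≥0∞ := ∑ j, c j * (A * E j) with hB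
  have hBt : 1 / 2 + B ≠ ∞ := by
    refine ENNReal.add_ne_top.2 ⟨by simp, ENNReal.sum_ne_top.2 fun j _ => ?_⟩
    exact ENNReal.mul_ne_top ENNReal.ofReal_ne_top
      (ENNReal.mul_ne_top hA (lintegral_exp_neg_mul_abs_ne_top (abs_pos.2 (hω j))))
  -- The final bound is `(1 + η) / 2 + η B`, so `η (1/2 + B) < 1/4` yields `3/4`.
  obtain ⟨η, hη0, hη⟩ := ENNReal.exists_nnreal_pos_mul_lt hBt (b := 1 / 4) (by simp)
  refine ⟨η, hη0, fun t ht => ?_⟩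
  have hg : ∀ j, Measurable fun s => ‖greenKernel (ω j) t s‖ₑ := fun j =>
    (measurable_greenKernel_right (ω j) t).enorm
  have hτ : ∀ k, AEMeasurable (fun s => ‖taylorCoeff n (fun i => r i s) l k‖ₑ)
      (volume.restrict (Ici t₀)) := fun k =>
    (locallyIntegrableOn_taylorCoeff hr hrn l k).aestronglyMeasurable.enorm
  have h1 : ∀ j, ∫⁻ s in Ici t₀, ‖greenKernel (ω j) t s‖ₑ *
      ((1 + η) * (∑ k ∈ Finset.Icc 1 (n - 1), ‖taylorCoeff n (fun i => r i s) l k‖ₑ) + η * A) ≤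
      (1 + η) * (∑ k ∈ Finset.Icc 1 (n - 1), ∫⁻ s in Ici t₀,
        ‖greenKernel (ω j) t s‖ₑ * ‖taylorCoeff n (fun i => r i s) l k‖ₑ) + η * (A * E j) := by
    intro j
    have e : ∀ s, ‖greenKernel (ω j) t s‖ₑ *
      ((1 + η) * (∑ k ∈ Finset.Icc 1 (n - 1), ‖taylorCoeff n (fun i => r i s) l k‖ₑ) + η * A) =
      (1 + η) * (∑ k ∈ Finset.Icc 1 (n - 1),
        ‖greenKernel (ω j) t s‖ₑ * ‖taylorCoeff n (fun i => r i s) l k‖ₑ) +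
        η * A * ‖greenKernel (ω j) t s‖ₑ := fun s => by rw [← Finset.mul_sum]; ring
    simp only [e]
    have e' : ∫⁻ s in Ici t₀, ∑ k ∈ Finset.Icc 1 (n - 1),
        ‖greenKernel (ω j) t s‖ₑ * ‖taylorCoeff n (fun i => r i s) l k‖ₑ =
        ∑ k ∈ Finset.Icc 1 (n - 1), ∫⁻ s in Ici t₀,
          ‖greenKernel (ω j) t s‖ₑ * ‖taylorCoeff n (fun i => r i s) l k‖ₑ :=
      lintegral_finsetSum' _ fun k _ => (hg j).aemeasurable.mul (hτ k)
    rw [lintegral_add_right _ ((hg j).const_mul _), lintegral_const_mul' _ _ (by simp),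
      lintegral_const_mul _ (hg j), e', ← mul_assoc]
    gcongr
    exact lintegral_enorm_greenKernel_le _ _ _
  have h2 : ∀ j, ∀ k ∈ Finset.Icc 1 (n - 1), c j * ∫⁻ s in Ici t₀,
        ‖greenKernel (ω j) t s‖ₑ * ‖taylorCoeff n (fun i => r i s) l k‖ₑ ≤
      ENNReal.ofReal (alphaTilde γ j / (‖bigGamma γ j‖ * (k ! : ℝ))) *
        (⨆ t ∈ Ici t₀, absGreen t₀ (ω j) (pertDeriv n r l k) t) := by
    intro j k _
    have hk : (0 : ℝ) < k ! := by exact_mod_cast k.factorial_pos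
    have e1 : absGreen t₀ (ω j) (pertDeriv n r l k) t = ENNReal.ofReal (k ! : ℝ) * ∫⁻ s in Ici t₀,
        ‖greenKernel (ω j) t s‖ₑ * ‖taylorCoeff n (fun i => r i s) l k‖ₑ := by
      rw [absGreen, ← lintegral_const_mul' _ _ ENNReal.ofReal_ne_top]
      refine lintegral_congr fun s => ?_
      have : ‖((k ! : ℕ) : ℂ)‖ₑ = ENNReal.ofReal (k ! : ℝ) := by
        rw [← ofReal_norm, Complex.norm_natCast]
      rw [pertDeriv_eq, enorm_mul, enorm_mul, this]; ring
    have e2 : c j = ENNReal.ofReal (alphaTilde γ j / (‖bigGamma γ j‖ * (k ! : ℝ))) *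
        ENNReal.ofReal (k ! : ℝ) := by
      rw [← ENNReal.ofReal_mul' hk.le, hc]
      rw [← div_div, div_mul_cancel₀ _ hk.ne']
    rw [e2, mul_assoc, ← e1]
    gcongr
    exact le_iSup₂ (f := fun t (_ : t ∈ Ici t₀) => absGreen t₀ (ω j) (pertDeriv n r l k) t) t ht
  calc _ ≤ ∑ j, c j * ((1 + η) * (∑ k ∈ Finset.Icc 1 (n - 1), ∫⁻ s in Ici t₀,
        ‖greenKernel (ω j) t s‖ₑ * ‖taylorCoeff n (fun i => r i s) l k‖ₑ) + η * (A * E j)) :=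
        Finset.sum_le_sum fun j _ => mul_le_mul' le_rfl (h1 j)
    _ = (1 + η) * (∑ j, ∑ k ∈ Finset.Icc 1 (n - 1), c j * ∫⁻ s in Ici t₀,
        ‖greenKernel (ω j) t s‖ₑ * ‖taylorCoeff n (fun i => r i s) l k‖ₑ) + η * B := by
        simp only [hB, ← Finset.mul_sum]
        rw [Finset.mul_sum, Finset.mul_sum, ← Finset.sum_add_distrib]
        exact Finset.sum_congr rfl fun j _ => by ring
    _ ≤ (1 + η) * (1 / 2) + η * B := by
        gcongr
        exact (Finset.sum_le_sum fun j _ => Finset.sum_le_sum (h2 j)).trans hcl.le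
    _ = 1 / 2 + η * (1 / 2 + B) := by ring
    _ ≤ 1 / 2 + 1 / 4 := by gcongr
    _ = _ := by
        rw [← ENNReal.toReal_eq_toReal_iff' (by simp) ENNReal.coe_ne_top, ENNReal.toReal_add (by simp) (by simp)]
        norm_num

/-- The correction `U` to the jet `Θ` of the first approximation. -/
theorem exists_jet_correction {n : ℕ} (hn : 2 ≤ n) {a : ℕ → ℂ} {r : ℕ → ℝ → ℂ} {l : ℂ} {t₀ : ℝ}
    (hr : ∀ i < n, LocallyIntegrableOn (r i) (Ici t₀)) (hrn : ∀ t, r n t = 0)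
    {γ : Fin (n - 1) → ℂ} (hγ : Function.Injective γ) {β : ℝ} (hβ : 0 < β)
    (hβlt : ∀ j, β < |(γ j).re|)
    (hcl : ∑ j, ∑ k ∈ Finset.Icc 1 (n - 1),
      ENNReal.ofReal (alphaTilde γ j / (‖bigGamma γ j‖ * (k ! : ℝ))) *
        (⨆ t ∈ Ici t₀,
          absGreen t₀ (((γ j).re - Real.sign (γ j).re * β : ℝ) : ℂ) (pertDeriv n r l k) t)
      < 1 / 2)
    {Θ : ℝ → Fin (n - 1) → ℂ} (hΘc : ContinuousOn Θ (Ici t₀)) (hΘ : Tendsto Θ atTop (𝓝 0))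
    {R : ℝ → ℂ} (hR : IntegrableOn R (Ici t₀))
    (hRΘ : ∀ t, t₀ ≤ t → remJet n a r l t (extendZero (Θ t)) = R t) :
    ∃ (T : ℝ) (U : ℝ → Fin (n - 1) → ℂ) (M : NNReal), t₀ ≤ T ∧ Continuous U ∧
      (∀ t, T ≤ t → ‖U t‖ₑ ≤ M * expAverage t₀ β R t) ∧
      LocallyIntegrableOn (fun s => remJet n a r l s (extendZero (Θ s + U s))) (Ici T) ∧
      (∀ j, GreenConverges T (γ j) fun s => remJet n a r l s (extendZero (Θ s + U s))) ∧
      ∀ t, T ≤ t → ∀ i : Fin (n - 1), U t i = -greenJet γ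
        (fun j => greenOmega T (γ j) fun s => remJet n a r l s (extendZero (Θ s + U s))) i t := by
  have hγ0 : ∀ j, (γ j).re ≠ 0 := fun j h => by
    have := hβlt j; rw [h, abs_zero] at this; linarith
  set ω : Fin (n - 1) → ℂ := fun j => (((γ j).re - Real.sign (γ j).re * β : ℝ) : ℂ) with hω
  have hω0 : ∀ j, (ω j).re ≠ 0 := fun j => by
    rw [hω, Complex.ofReal_re, ← abs_pos, (sign_sub_and_abs_sub hβ (hβlt j)).2]
    linarith [hβlt j]
  have hA : ∑ i ∈ Finset.Icc 2 n, ‖taylorCoeff n a l i‖ₑ ≠ ∞ :=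
    ENNReal.sum_ne_top.2 fun i _ => enorm_ne_top
  obtain ⟨η, hη0, hη⟩ := exists_contraction_bound (ω := ω) hr hrn hω0 hcl hA
  obtain ⟨δ, hδ0, hδ⟩ := exists_norm_bell_sub_le (m := n - 1) n (NNReal.coe_pos.2 hη0)
  set κ : ℝ → ℝ≥0∞ := fun s =>
    (1 + η) * (∑ k ∈ Finset.Icc 1 (n - 1), ‖taylorCoeff n (fun i => r i s) l k‖ₑ) +
      η * ∑ i ∈ Finset.Icc 2 n, ‖taylorCoeff n a l i‖ₑ with hκ
  set C : Fin (n - 1) → ℝ≥0∞ := fun j => ENNReal.ofReal (alphaTilde γ j / ‖bigGamma γ j‖) with hC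
  have hw := fun j => bigGamma_weight γ j (bigGamma_ne_zero hγ j) (by omega)
  -- Solves $\sum_j C_j+\tfrac34M=M$, the invariance condition for contraction constant `3/4`.
  set M : NNReal := 4 * (∑ j, C j).toNNReal with hMdef
  have hMC : (M : ℝ≥0∞) = 4 * ∑ j, C j := by
    rw [hMdef, ENNReal.coe_mul, ENNReal.coe_toNNReal
      (ENNReal.sum_ne_top.2 fun j _ => ENNReal.ofReal_ne_top)]
    rfl
  -- Half of the radius `δ` goes to the jet of `θ` and half to the correction, so that their sum
  -- stays where the Bell estimate holds.
  have hev : ∀ᶠ t in atTop, ‖Θ t‖ ≤ δ / 2 ∧ M * expAverage t₀ β R t ≤ ENNReal.ofReal (δ / 2) := by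
    refine Filter.Eventually.and ?_ ?_
    · have := hΘ.norm
      rw [norm_zero] at this
      exact (this.eventually (ge_mem_nhds (half_pos hδ0)))
    · have h1 := ENNReal.Tendsto.const_mul (tendsto_expAverage hβ hR)
        (Or.inr (ENNReal.coe_ne_top (r := M)))
      rw [mul_zero] at h1
      exact h1.eventually (ge_mem_nhds (ENNReal.ofReal_pos.2 (half_pos hδ0)))
  obtain ⟨T₁, hT₁⟩ := eventually_atTop.1 hev
  set T := max t₀ T₁ with hTdef
  have hT0 : t₀ ≤ T := le_max_left _ _
  have hT : ∀ t, T ≤ t → ‖Θ t‖ ≤ δ / 2 ∧ M * expAverage t₀ β R t ≤ ENNReal.ofReal (δ / 2) :=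
    fun t ht => hT₁ t ((le_max_right _ _).trans ht)
  have hloc : ∀ U : ℝ → Fin (n - 1) → ℂ, Continuous U →
      LocallyIntegrableOn (fun s => remJet n a r l s (extendZero (Θ s + U s))) (Ici T) :=
    fun U hU => locallyIntegrableOn_remJet
      (fun i hi => (hr i hi).mono_set (Ici_subset_Ici.2 hT0)) hrn
      (continuous_extendZero.comp_continuousOn
        ((hΘc.mono (Ici_subset_Ici.2 hT0)).add hU.continuousOn))
  have hκT : ∀ t, T ≤ t → ∑ j, C j * ∫⁻ s in Ici T, ‖greenKernel (ω j) t s‖ₑ * κ s ≤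
      ((3 / 4 : NNReal) : ℝ≥0∞) := fun t ht => by
    refine le_trans (Finset.sum_le_sum fun j _ => mul_le_mul' le_rfl ?_) (hη t (hT0.trans ht))
    exact lintegral_mono_set (Ici_subset_Ici.2 hT0)
  obtain ⟨U, hUc, hUρ, hUconv, hU⟩ := exists_green_fixedPoint (T := T) hγ0
    (d := fun i j => γ j ^ (i : ℕ) / bigGamma γ j) (C := C)
    (fun j => (ENNReal.ofReal_pos.2 (hw j).1).ne')
    (fun i j => by
      rw [← ofReal_norm]; exact ENNReal.ofReal_le_ofReal ((hw j).2 i i.2))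
    (fun s V => remJet n a r l s (extendZero (Θ s + V))) κ (expAverage t₀ β R)
    (half_pos hδ0).le (M := M) (q := 3 / 4) (by
      rw [← NNReal.coe_lt_coe]; push_cast; norm_num) hloc
    (fun s hs x y hx hy => by
      have h1 := enorm_remJet_sub_le hn (a := a) (r := r) (l := l) (s := s) (hrn s) (η := η)
        (x := Θ s + x) (y := Θ s + y) fun i hi => hδ i hi _ _
          ((norm_add_le _ _).trans (by linarith [(hT s hs).1]))
          ((norm_add_le _ _).trans (by linarith [(hT s hs).1]))
      rwa [add_sub_add_left_eq_sub] at h1)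
    (fun t _ => ne_top_of_le_ne_top hR.2.ne (expAverage_le hβ R t))
    (fun t ht => (hT t ht).2)
    (fun t ht j => by
      refine le_trans (le_of_eq ?_) (absGreen_le_expAverage (hβlt j) hT0 R t)
      refine setLIntegral_congr_fun measurableSet_Ici fun s hs => ?_
      dsimp only
      rw [add_zero, hRΘ s (hT0.trans hs)])
    (fun t ht => by
      refine le_trans (Finset.sum_le_sum fun j _ => mul_le_mul' le_rfl ?_) (hκT t ht)
      refine lintegral_mono fun s => mul_le_mul' ?_ le_rfl
      exact enorm_greenKernel_le_sub hβ (hβlt j) t s)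
    (fun t ht => by
      calc _ ≤ ∑ j, C j * ((∫⁻ s in Ici T, ‖greenKernel (ω j) t s‖ₑ * κ s) *
            expAverage t₀ β R t) := by
            refine Finset.sum_le_sum fun j _ => mul_le_mul' le_rfl ?_
            rw [← lintegral_mul_const' _ _
              (ne_top_of_le_ne_top hR.2.ne (expAverage_le hβ R t))]
            refine lintegral_mono fun s => ?_
            have := enorm_greenKernel_mul_expAverage_le hβ (hβlt j) (t₀ := t₀) R t s
            calc _ = (‖greenKernel (γ j) t s‖ₑ * expAverage t₀ β R s) * κ s := by ring
              _ ≤ (‖greenKernel (ω j) t s‖ₑ * expAverage t₀ β R t) * κ s := by gcongr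
              _ = _ := by ring
        _ = (∑ j, C j * ∫⁻ s in Ici T, ‖greenKernel (ω j) t s‖ₑ * κ s) * expAverage t₀ β R t := by
            rw [Finset.sum_mul]; exact Finset.sum_congr rfl fun j _ => by ring
        _ ≤ _ := by gcongr; exact hκT t ht)
    (by
      have e : ((3 / 4 : NNReal) : ℝ≥0∞) * 4 = 3 := by
        rw [show (4 : ℝ≥0∞) = ((4 : NNReal) : ℝ≥0∞) from rfl, ← ENNReal.coe_mul,
          div_mul_cancel₀ _ (by norm_num)]
        rfl
      rw [hMC, ← mul_assoc, e]
      exact le_of_eq (by ring))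
  exact ⟨T, U, M, hT0, hUc, hUρ, hloc U hUc, hUconv, hU⟩

/-! ### From the Riccati equation back to the linear equation. -/

/-- A solution of the Riccati type equation near infinity yields a solution of the linear
equation on the whole half-line. -/
theorem exists_isSolution_of_riccati {n : ℕ} (hn : 2 ≤ n) {a : ℕ → ℂ} (ha : a n = 1)
    {r : ℕ → ℝ → ℂ} {t₀ T : ℝ} (hT : t₀ ≤ T) (hr : ∀ i < n, LocallyIntegrableOn (r i) (Ici t₀))
    (hrn : ∀ t, r n t = 0) {l : ℂ} (hl : (charPoly n a).IsRoot l)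
    {Z : ℕ → ℝ → ℂ} (hZ : ∀ i < n - 1, IsPrimitiveOn (Z i) (Z (i + 1)) T)
    (heq : ∀ t, T ≤ t → (∑ k ∈ Finset.range n, taylorCoeff n a l (k + 1) * Z k t) +
      pertDeriv n r l 0 t + remJet n a r l t (fun i => Z i t) = 0)
    {y₀ : ℝ → ℂ} (hy₀ : IsPrimitiveOn y₀ (fun t => (l + Z 0 t) * y₀ t) T) :
    ∃ y : ℝ → ℂ, IsSolution n a r t₀ y ∧ ∀ i ≤ n - 1, ∀ t, T ≤ t →
      iteratedDerivWithin i y (Ici t₀) t = y₀ t * binomialShift l (bell fun j => Z j t) i := by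
  refine exists_isSolution_extension hn hT hr
    (Y := fun i t => y₀ t * binomialShift l (bell fun j => Z j t) i)
    (fun i hi => isPrimitiveOn_mul_binomialShift_bell hy₀ i fun j hj => hZ j (by omega)) ?_
  refine (isPrimitiveOn_mul_binomialShift_bell hy₀ (n - 1) hZ).congr (fun _ _ => rfl) fun t ht => ?_
  have h1 := sum_mul_binomialShift_bell hn hl t (hrn t) (fun i => Z i t)
  -- The term of index `n` has coefficient `a n + r n t = 1`, so the identity solves for the highest
  -- derivative.
  rw [add_assoc, ← remJet, heq t ht, Finset.sum_range_succ, ha, hrn t, add_zero, one_mul] at h1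
  rw [Nat.sub_add_cancel (by omega), eq_neg_of_add_eq_zero_right h1, mul_neg, Finset.mul_sum,
    neg_inj.2]
  exact Finset.sum_congr rfl fun i _ => by ring

theorem IsPrimitiveOn.neg {F f : ℝ → ℂ} {a : ℝ} (h : IsPrimitiveOn F f a) :
    IsPrimitiveOn (fun t => -F t) (fun t => -f t) a :=
  (h.const_mul (-1)).congr (fun _ _ => by ring) fun _ _ => by ring

theorem IsPrimitiveOn.cexp {F f : ℝ → ℂ} {a : ℝ} (h : IsPrimitiveOn F f a)
    (hf : ContinuousOn f (Ici a)) :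
    IsPrimitiveOn (fun t => Complex.exp (F t)) (fun t => f t * Complex.exp (F t)) a := by
  refine .of_hasDerivWithinAt (hf.mul h.continuousOn.cexp) fun t ht => ?_
  rw [mul_comm]
  exact (h.hasDerivWithinAt hf ht).cexp

theorem greenJet_add {m : ℕ} (γ : Fin m → ℂ) (V W : Fin m → ℝ → ℂ) (i : ℕ) (t : ℝ) :
    greenJet γ (fun j t => V j t + W j t) i t = greenJet γ V i t + greenJet γ W i t := by
  simp only [greenJet, mul_add, Finset.sum_add_distrib]

/-- The system of derivatives of `-∑_j Γ_j⁻¹ V_j`, closed at order `m` by the equation. -/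
noncomputable def riccatiJet {m : ℕ} (γ : Fin m → ℂ) (V : Fin m → ℝ → ℂ) (f : ℝ → ℂ) (i : ℕ)
    (t : ℝ) : ℂ :=
  if i < m then -greenJet γ V i t else -(greenJet γ V m t + f t)

theorem isPrimitiveOn_riccatiJet {m : ℕ} {γ : Fin m → ℂ} (hγ : Function.Injective γ)
    {V : Fin m → ℝ → ℂ} {f : ℝ → ℂ} {a : ℝ}
    (hV : ∀ j, IsPrimitiveOn (V j) (fun t => γ j * V j t + f t) a) (i : ℕ) (hi : i < m) :
    IsPrimitiveOn (riccatiJet γ V f i) (riccatiJet γ V f (i + 1)) a := by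
  rcases (show i + 1 ≤ m by omega).lt_or_eq with h | h
  · refine (isPrimitiveOn_greenJet hγ hV (i := i) (by omega)).neg.congr (fun t _ => ?_) fun t _ => ?_
    · simp [riccatiJet, hi]
    · simp [riccatiJet, h]
  · obtain rfl : i = m - 1 := by omega
    refine (isPrimitiveOn_greenJet_last hγ (by omega) hV).neg.congr (fun t _ => ?_) fun t _ => ?_
    · simp [riccatiJet, hi]
    · simp [riccatiJet, h]

/-- The Green jets cancel because each `γ j` is a characteristic root; what survives is the forcing
in the top entry, whose coefficient is `a n = 1`. -/
theorem sum_taylorCoeff_mul_riccatiJet {n : ℕ} (hn : 2 ≤ n) {a : ℕ → ℂ} (ha : a n = 1) {l : ℂ}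
    {γ : Fin (n - 1) → ℂ} (hγ0 : ∀ j, γ j ≠ 0) (hl : (charPoly n a).IsRoot l)
    (hγl : ∀ j, (charPoly n a).IsRoot (γ j + l)) (V : Fin (n - 1) → ℝ → ℂ) (f : ℝ → ℂ) (t : ℝ) :
    ∑ k ∈ Finset.range n, taylorCoeff n a l (k + 1) * riccatiJet γ V f k t = -f t := by
  have h1 : ∑ k ∈ Finset.range n, taylorCoeff n a l (k + 1) * greenJet γ V k t = 0 := by
    simp only [greenJet, Finset.mul_sum]
    rw [Finset.sum_comm]
    refine Finset.sum_eq_zero fun j _ => ?_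
    have := sum_taylorCoeff_succ_mul_pow_eq_zero (hγ0 j) hl (hγl j)
    calc _ = (∑ k ∈ Finset.range n, taylorCoeff n a l (k + 1) * γ j ^ k) *
          (V j t / bigGamma γ j) := by
          rw [Finset.sum_mul]; exact Finset.sum_congr rfl fun k _ => by ring
      _ = 0 := by rw [this, zero_mul]
  obtain ⟨m, rfl⟩ : ∃ m, n = m + 1 := ⟨n - 1, by omega⟩
  rw [Finset.sum_range_succ] at h1 ⊢
  rw [taylorCoeff_self, ha, one_mul] at h1 ⊢
  have h2 : ∑ k ∈ Finset.range m, taylorCoeff (m + 1) a l (k + 1) * riccatiJet γ V f k t =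
      -∑ k ∈ Finset.range m, taylorCoeff (m + 1) a l (k + 1) * greenJet γ V k t := by
    rw [← Finset.sum_neg_distrib]
    refine Finset.sum_congr rfl fun k hk => ?_
    rw [riccatiJet, if_pos (by simpa using hk)]; ring
  rw [h2, riccatiJet, if_neg (by simp)]
  simp only [Nat.add_sub_cancel]
  linear_combination -h1

/-- Dividing $V_j'=\gamma_jV_j+p$ by $\Gamma_j\gamma_j$ trades $V_j/\Gamma_j$ for a derivative and a
multiple of $p$; the multiples add up to the constant of `sum_one_div_bigGamma_mul`. -/
theorem isPrimitiveOn_exponent {m : ℕ} (hm : 1 ≤ m) {γ : Fin m → ℂ} (hγ : Function.Injective γ)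
    (hγ0 : ∀ j, γ j ≠ 0) {V : Fin m → ℝ → ℂ} {p : ℝ → ℂ} {t₀ : ℝ}
    (hp : LocallyIntegrableOn p (Ici t₀))
    (hV : ∀ j, IsPrimitiveOn (V j) (fun t => γ j * V j t + p t) t₀) :
    IsPrimitiveOn (fun t => -(∑ j, (1 / (bigGamma γ j * γ j)) * V j t) +
        (-1) ^ (m - 1) * (∏ k, (γ k)⁻¹) * ∫ s in t₀..t, p s)
      (fun t => -greenJet γ V 0 t) t₀ := by
  have h1 := (IsPrimitiveOn.sum Finset.univ fun j _ =>
    (hV j).const_mul (1 / (bigGamma γ j * γ j))).neg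
  have h2 : IsPrimitiveOn (fun t => ∫ s in t₀..t, p s) p t₀ := ⟨hp, fun t _ => by simp⟩
  refine (h1.add (h2.const_mul ((-1) ^ (m - 1) * ∏ k, (γ k)⁻¹))).congr (fun _ _ => rfl)
    fun t _ => ?_
  rw [← sum_one_div_bigGamma_mul hm hγ hγ0, Finset.sum_mul, ← sub_eq_neg_add,
    ← Finset.sum_sub_distrib, greenJet, ← Finset.sum_neg_distrib]
  refine Finset.sum_congr rfl fun j _ => ?_
  have := hγ0 j
  have := bigGamma_ne_zero hγ j
  field_simp
  ring

theorem isPrimitiveOn_neg_integral_Ioi {w : ℝ → ℂ} {T : ℝ} (hw : IntegrableOn w (Ioi T)) :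
    IsPrimitiveOn (fun t => -∫ s in Ioi t, w s) w T := by
  have hw' : IntegrableOn w (Ici T) := by
    rwa [integrableOn_Ici_iff_integrableOn_Ioi]
  refine ⟨hw'.locallyIntegrableOn, fun t ht => ?_⟩
  rw [← intervalIntegral.integral_Ioi_sub_Ioi hw ht]
  ring

end PoincarePerron

/-! ### Assembly of the main theorem. -/

open PoincarePerron in
theorem mainTheorem7
    (n : ℕ) (hn : 2 ≤ n) (t₀ : ℝ)
    (a : ℕ → ℂ) (ha : a n = 1)
    (r : ℕ → ℝ → ℂ) (hr : ∀ i < n, LocallyIntegrableOn (r i) (Ici t₀)) (hrn : ∀ t, r n t = 0)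
    -- the roots of the characteristic polynomial, with pairwise distinct real parts
    (l : ℂ) (ls : Fin (n - 1) → ℂ)
    (hl : (charPoly n a).IsRoot l) (hls : ∀ j, (charPoly n a).IsRoot (ls j))
    (hre : ∀ j, (ls j).re ≠ l.re) (hinj : Function.Injective (fun j => (ls j).re))
    (γ : Fin (n - 1) → ℂ) (hγ : ∀ j, γ j = ls j - l)
    (p : ℝ → ℂ) (hp : ∀ t, p t = pertDeriv n r l 0 t)
    -- the Green operator applied to `P(r;λ)` is defined, and tends to `0` with its derivatives
    (hconv : ∀ j, GreenConverges t₀ (γ j) p)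
    (hzero : Tendsto
      (fun t => ∑ i ∈ Finset.range (n - 1), ‖iteratedDerivWithin i (greenOp t₀ γ p) (Ici t₀) t‖)
      atTop (𝓝 0))
    (θ : ℝ → ℂ) (hθ : ∀ t, θ t = -greenOp t₀ γ p t)
    (hR : IntegrableOn (remTerm n a r l t₀ θ) (Ici t₀))
    (β : ℝ) (hβ : 0 < β) (hβlt : ∀ j, β < |(γ j).re|)
    (hcl : ∑ j, ∑ k ∈ Finset.Icc 1 (n - 1),
      ENNReal.ofReal (alphaTilde γ j / (‖bigGamma γ j‖ * (k ! : ℝ))) *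
        (⨆ t ∈ Ici t₀,
          absGreen t₀ (((γ j).re - Real.sign (γ j).re * β : ℝ) : ℂ) (pertDeriv n r l k) t)
      < 1 / 2) :
    ∃ y : ℝ → ℂ, IsSolution n a r t₀ y ∧
      (∀ᶠ t in atTop, y t ≠ 0) ∧
      (∀ i ∈ Finset.Icc 1 (n - 1),
        Tendsto (fun t => iteratedDerivWithin i y (Ici t₀) t / y t) atTop (𝓝 (l ^ i))) ∧
      (∫⁻ s in Ici t₀, (absGreen t₀ (β : ℂ) (remTerm n a r l t₀ θ) s +
          absGreen t₀ (-β : ℂ) (remTerm n a r l t₀ θ) s)) ≠ ⊤ ∧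
      ∃ ε : ℝ → ℂ,
        (∀ t, t₀ ≤ t → y t = (1 + ε t) * Complex.exp (l * ((t : ℂ) - (t₀ : ℂ))) *
          Complex.exp (-(∑ j, (1 / (bigGamma γ j * γ j)) * greenOmega t₀ (γ j) p t) +
            (-1) ^ n * (∏ k, (ls k - l)⁻¹) * ∫ s in t₀..t, p s)) ∧
        ε =O[atTop] (fun t => (∫⁻ s in Ioi t,
          (absGreen t₀ (β : ℂ) (remTerm n a r l t₀ θ) s +
            absGreen t₀ (-β : ℂ) (remTerm n a r l t₀ θ) s)).toReal) := by
  have hm : 1 ≤ n - 1 := by omega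
  have hγinj : Function.Injective γ := fun i j h => hinj (by
    simp only [hγ, sub_left_inj] at h
    simp only [h])
  have hγre : ∀ j, (γ j).re ≠ 0 := fun j => by
    rw [hγ, Complex.sub_re]; exact sub_ne_zero.2 (hre j)
  have hγ0 : ∀ j, γ j ≠ 0 := fun j h => hγre j (by rw [h]; rfl)
  have hploc : LocallyIntegrableOn p (Ici t₀) := by
    refine (locallyIntegrableOn_taylorCoeff hr hrn l 0).congr (Eventually.of_forall fun t => ?_)
    simp [hp, pertDeriv_eq]
  set V : Fin (n - 1) → ℝ → ℂ := fun j => greenOmega t₀ (γ j) p with hVdef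
  have hV : ∀ j, IsPrimitiveOn (V j) (fun t => γ j * V j t + p t) t₀ := fun j =>
    isPrimitiveOn_greenOmega (hγre j) hploc (hconv j)
  have hjetG : ∀ i < n - 1, ∀ t, t₀ ≤ t →
      iteratedDerivWithin i (greenOp t₀ γ p) (Ici t₀) t = greenJet γ V i t := fun i hi t ht =>
    iteratedDerivWithin_greenOp hγinj hm hV hi ht
  have hjet : ∀ i < n - 1, ∀ t, t₀ ≤ t → jet t₀ θ t i = -greenJet γ V i t := fun i hi t ht => by
    rw [← hjetG i hi t ht, jet, show θ = -greenOp t₀ γ p from funext hθ, iteratedDerivWithin_neg]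
  set Θ : ℝ → Fin (n - 1) → ℂ := fun t i => -greenJet γ V i t with hΘdef
  have hVc : ∀ i, ContinuousOn (greenJet γ V i) (Ici t₀) := fun i =>
    continuousOn_finsetSum _ fun j _ => continuousOn_const.mul (hV j).continuousOn
  have hΘc : ContinuousOn Θ (Ici t₀) := continuousOn_pi.2 fun i => (hVc i).neg
  have hΘ : Tendsto Θ atTop (𝓝 0) := by
    refine tendsto_pi_nhds.2 fun i => ?_
    refine squeeze_zero_norm' ?_ hzero
    filter_upwards [eventually_ge_atTop t₀] with t ht
    rw [hΘdef, norm_neg, ← hjetG i i.2 t ht]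
    exact Finset.single_le_sum (f := fun i => ‖iteratedDerivWithin i (greenOp t₀ γ p) (Ici t₀) t‖)
      (fun _ _ => norm_nonneg _) (Finset.mem_range.2 i.2)
  set R : ℝ → ℂ := remTerm n a r l t₀ θ with hRdef
  have hRΘ : ∀ t, t₀ ≤ t → remJet n a r l t (extendZero (Θ t)) = R t := fun t ht => by
    refine remJet_congr fun k hk => ?_
    rw [hjet k hk t ht]; simp [extendZero, hk, hΘdef]
  have hρeq : ∀ t, absGreen t₀ (β : ℂ) R t + absGreen t₀ (-β : ℂ) R t = expAverage t₀ β R t :=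
    fun t => absGreen_add_absGreen_neg hβ hR.locallyIntegrableOn t
  simp only [hρeq]
  have hρint := lintegral_expAverage_ne_top hβ hR
  obtain ⟨T, U, M, hT, hUc, hUρ, hHloc, hHconv, hU⟩ :=
    exists_jet_correction hn hr hrn hγinj hβ hβlt hcl hΘc hΘ hR hRΘ
  set H : ℝ → ℂ := fun s => remJet n a r l s (extendZero (Θ s + U s)) with hH
  set W : Fin (n - 1) → ℝ → ℂ := fun j => greenOmega T (γ j) H with hWdef
  -- `V j` integrates from `t₀` and `W j` from `T`, but on `[T, ∞)` both satisfy the first order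
  -- equation with root `γ j`, so the forcings add.
  have hVW : ∀ j, IsPrimitiveOn (fun t => V j t + W j t)
      (fun t => γ j * (V j t + W j t) + (p t + H t)) T := fun j =>
    (((hV j).mono hT).add (isPrimitiveOn_greenOmega (hγre j) hHloc (hHconv j))).congr
      (fun _ _ => rfl) fun t _ => by ring
  set Z : ℕ → ℝ → ℂ := riccatiJet γ (fun j t => V j t + W j t) (fun t => p t + H t) with hZdef
  have hZX : ∀ k < n - 1, ∀ t, T ≤ t → Z k t = extendZero (Θ t + U t) k := fun k hk t ht => by
    have := hU t ht ⟨k, hk⟩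
    simp only [hZdef, riccatiJet, hk, if_true, greenJet_add, extendZero, dif_pos, Pi.add_apply,
      this, hΘdef]
    ring
  have hZprim : ∀ i < n - 1, IsPrimitiveOn (Z i) (Z (i + 1)) T := fun i hi =>
    isPrimitiveOn_riccatiJet hγinj hVW i hi
  -- the logarithm of the solution
  set w : ℝ → ℂ := fun t => U t ⟨0, hm⟩ with hwdef
  have hwc : Continuous w := (continuous_apply _).comp hUc
  have hwρ : ∀ t, T ≤ t → ‖w t‖ₑ ≤ M * expAverage t₀ β R t := fun t ht => by
    refine le_trans ?_ (hUρ t ht)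
    rw [← ofReal_norm, ← ofReal_norm]
    exact ENNReal.ofReal_le_ofReal (norm_le_pi_norm (U t) _)
  have hwb : ∀ t, T ≤ t → ∫⁻ s in Ioi t, ‖w s‖ₑ ≤ M * ∫⁻ s in Ioi t, expAverage t₀ β R s :=
    fun t ht => by
      rw [← lintegral_const_mul' _ _ ENNReal.coe_ne_top]
      exact setLIntegral_mono' measurableSet_Ioi fun s hs => hwρ s (ht.trans (le_of_lt hs))
  have hρt : ∀ t, t₀ ≤ t → ∫⁻ s in Ioi t, expAverage t₀ β R s ≠ ∞ := fun t ht =>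
    ne_top_of_le_ne_top hρint (lintegral_mono_set fun s hs => ht.trans (le_of_lt hs))
  have hwint : IntegrableOn w (Ioi T) := ⟨hwc.aestronglyMeasurable,
    (hwb T le_rfl).trans_lt (ENNReal.mul_lt_top ENNReal.coe_lt_top (hρt T hT).lt_top)⟩
  set Q : ℝ → ℂ := fun t => -(∑ j, (1 / (bigGamma γ j * γ j)) * V j t) +
    (-1) ^ n * (∏ k, (ls k - l)⁻¹) * ∫ s in t₀..t, p s with hQdef
  have hQ : IsPrimitiveOn Q (fun t => -greenJet γ V 0 t) t₀ := by
    have h1 := isPrimitiveOn_exponent hm hγinj hγ0 hploc hV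
    have h2 : (-1 : ℂ) ^ (n - 1 - 1) = (-1) ^ n := by
      obtain ⟨k, rfl⟩ : ∃ k, n = k + 2 := ⟨n - 2, by omega⟩
      rw [show k + 2 - 1 - 1 = k from rfl, pow_add]; norm_num
    rw [h2, show ∏ k, (γ k)⁻¹ = ∏ k, (ls k - l)⁻¹ from
      Finset.prod_congr rfl fun k _ => by rw [hγ]] at h1
    exact h1
  -- Normalising the primitive of the correction at infinity makes it tend to `0`, so the limiting
  -- constant in front of the exponentials is exactly `1`.
  set S : ℝ → ℂ := fun t => -∫ s in Ioi t, w s with hSdef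
  have hS : IsPrimitiveOn S w T := isPrimitiveOn_neg_integral_Ioi hwint
  have hlin : IsPrimitiveOn (fun t : ℝ => l * ((t : ℂ) - (t₀ : ℂ))) (fun _ => l) T := by
    refine .of_hasDerivWithinAt continuousOn_const fun t _ => ?_
    have := ((Complex.ofRealCLM.hasDerivAt (x := t)).sub_const (t₀ : ℂ)).const_mul l
    simpa using! this.hasDerivWithinAt
  set y₀ : ℝ → ℂ := fun t => Complex.exp (l * ((t : ℂ) - (t₀ : ℂ)) + (Q t + S t)) with hy₀def
  have hZ0 : ∀ t, T ≤ t → Z 0 t = -greenJet γ V 0 t + w t := fun t ht => by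
    have h0 : 0 < n - 1 := hm
    rw [hZX 0 hm t ht]
    simp [extendZero, h0, hΘdef, hwdef]
  have hy₀ : IsPrimitiveOn y₀ (fun t => (l + Z 0 t) * y₀ t) T := by
    refine ((hlin.add ((hQ.mono hT).add hS)).cexp ?_).congr (fun _ _ => rfl) fun t ht => ?_
    · exact continuousOn_const.add
        (((hVc 0).mono (Ici_subset_Ici.2 hT)).neg.add hwc.continuousOn)
    · rw [hZ0 t ht]
  have heq : ∀ t, T ≤ t → (∑ k ∈ Finset.range n, taylorCoeff n a l (k + 1) * Z k t) +
      pertDeriv n r l 0 t + remJet n a r l t (fun i => Z i t) = 0 := fun t ht => by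
    have h1 : remJet n a r l t (fun i => Z i t) = H t := remJet_congr fun k hk => hZX k hk t ht
    rw [h1, hZdef, sum_taylorCoeff_mul_riccatiJet hn ha hγ0 hl
      (fun j => by rw [hγ, sub_add_cancel]; exact hls j), ← hp]
    ring
  obtain ⟨y, hy, hyT⟩ := exists_isSolution_of_riccati hn ha hT hr hrn hl hZprim heq hy₀
  have hyT0 : ∀ t, T ≤ t → y t = y₀ t := fun t ht => by
    have := hyT 0 (by omega) t ht
    rwa [iteratedDerivWithin_zero, binomialShift_zero, bell_zero, mul_one] at this
  have hy₀ne : ∀ t, y₀ t ≠ 0 := fun t => Complex.exp_ne_zero _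
  refine ⟨y, hy, ?_, ?_, hρint, ?_⟩
  · filter_upwards [eventually_ge_atTop T] with t ht
    rw [hyT0 t ht]; exact hy₀ne t
  · intro i hi
    have hi' := (Finset.mem_Icc.1 hi).2
    have hUlim : Tendsto U atTop (𝓝 0) := by
      rw [tendsto_zero_iff_norm_tendsto_zero]
      have h1 := ENNReal.Tendsto.const_mul (tendsto_expAverage hβ hR)
        (Or.inr (ENNReal.coe_ne_top (r := M)))
      rw [mul_zero] at h1
      have h2 : Tendsto (fun t => ‖U t‖ₑ) atTop (𝓝 0) := by
        refine tendsto_of_tendsto_of_tendsto_of_le_of_le' tendsto_const_nhds h1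
          (Eventually.of_forall fun _ => zero_le) ?_
        filter_upwards [eventually_ge_atTop T] with t ht using hUρ t ht
      simpa only [Function.comp_def, toReal_enorm, ENNReal.toReal_zero] using
        (ENNReal.tendsto_toReal ENNReal.zero_ne_top).comp h2
    have hX : Tendsto (fun t => extendZero (Θ t + U t)) atTop (𝓝 fun _ => 0) := by
      have h1 := hΘ.add hUlim
      rw [add_zero] at h1
      have h2 := (continuous_extendZero (m := n - 1)).tendsto 0
      rw [extendZero_zero] at h2
      exact h2.comp h1
    have hB : Continuous fun x : ℕ → ℂ => binomialShift l (bell x) i :=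
      continuous_finsetSum _ fun k _ => continuous_const.mul (continuous_bell k)
    -- At the zero jet all Bell polynomials of positive index vanish, leaving `l ^ i`.
    have hlim := (hB.tendsto fun _ => 0).comp hX
    rw [binomialShift_bell_zero] at hlim
    refine hlim.congr' ?_
    filter_upwards [eventually_ge_atTop T] with t ht
    rw [hyT i hi' t ht, hyT0 t ht, mul_div_cancel_left₀ _ (hy₀ne t), Function.comp_apply]
    refine Finset.sum_congr rfl fun k hk => ?_
    have := Finset.mem_range.1 hk
    rw [bell_congr k fun j hj => hZX j (by omega) t ht]
  -- Defined as a quotient, `ε` satisfies the formula on all of `[t₀, ∞)`; only the estimate uses `t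
  -- ≥ T`, where it equals $e^{S(t)}-1$.
  · refine ⟨fun t => y t / (Complex.exp (l * ((t : ℂ) - (t₀ : ℂ))) * Complex.exp (Q t)) - 1,
      fun t _ => ?_, ?_⟩
    · rw [add_sub_cancel, mul_assoc, div_mul_cancel₀]
      exact mul_ne_zero (Complex.exp_ne_zero _) (Complex.exp_ne_zero _)
    · have hε : ∀ t, T ≤ t → y t / (Complex.exp (l * ((t : ℂ) - (t₀ : ℂ))) * Complex.exp (Q t)) - 1 =
          Complex.exp (S t) - 1 := fun t ht => by
        rw [hyT0 t ht, hy₀def]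
        simp only [Complex.exp_add]
        have h1 := Complex.exp_ne_zero (l * ((t : ℂ) - (t₀ : ℂ)))
        have h2 := Complex.exp_ne_zero (Q t)
        field_simp
      have hSb : ∀ t, T ≤ t → ‖S t‖ ≤ M * (∫⁻ s in Ioi t, expAverage t₀ β R s).toReal :=
        fun t ht => by
          rw [hSdef, norm_neg, ← toReal_enorm, ← ENNReal.coe_toReal, ← ENNReal.toReal_mul]
          exact ENNReal.toReal_mono (ENNReal.mul_ne_top ENNReal.coe_ne_top (hρt t (hT.trans ht)))
            ((enorm_integral_le_lintegral_enorm _).trans (hwb t ht))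
      have hS0 : Tendsto S atTop (𝓝 0) := by
        have h1 := (intervalIntegral_tendsto_integral_Ioi T hwint tendsto_id).add_const (S T)
        simp only [hSdef, add_neg_cancel] at h1
        refine h1.congr' ?_
        filter_upwards [eventually_ge_atTop T] with t ht
        have := hS.eq t ht
        simp only [hSdef] at this
        rw [add_comm, id, ← this]
      have hS1 := hS0.norm
      rw [norm_zero] at hS1
      -- The `2` comes from $|e^x-1|\le2|x|$ for $|x|\le1$.
      refine Asymptotics.IsBigO.of_bound (2 * M) ?_
      filter_upwards [eventually_ge_atTop T, hS1.eventually (ge_mem_nhds one_pos)] with t ht h1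
      rw [hε t ht, Real.norm_of_nonneg ENNReal.toReal_nonneg, mul_assoc]
      exact (Complex.norm_exp_sub_one_le h1).trans
        (mul_le_mul_of_nonneg_left (hSb t ht) (by norm_num))
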